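/- A Salem polynomial is an irreducible, monic, reciprocal polynomial with integer coefficients that has exactly two complex roots of absolute value different from \(1\) (degree two is allowed), and a Salem number is a real number \(\lambda>1\) that is the largest real root of a Salem polynomial. A two-dimensional complex torus is a quotient \(\mathbb{C}^2/\Lambda\) with \(\Lambda\subseteq\mathbb{C}^2\) a lattice (a discrete subgroup spanning \(\mathbb{C}^2\) over \(\mathbb{R}\)); its automorphisms are its biholomorphic self-maps (not assumed to fix the origin), and the entropy of an automorphism is its topological entropy. Theorem 1.2. Let \(\lambda\) be a Salem number such that \(\log\lambda\) is the entropy of some automorphism of a two-dimensional complex torus. Then at least one of the following holds: 1) one of \(\lambda+\lambda^{-1}+2\) or \(\lambda+\lambda^{-1}-2\) is the square of an integer; 2) up to isomorphism (biholomorphic equivalence), there are only finitely many two-dimensional complex tori that admit an automorphism of entropy \(\log\lambda\). -/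

import Mathlib

open Topology

/-- A Salem polynomial: an irreducible polynomial with integer coefficients that is monic and
reciprocal and has exactly two complex roots whose magnitude is not one. -/
def IsSalemPolynomial (S : Polynomial ℤ) : Prop :=
  S.Monic ∧ Irreducible S ∧ S.reverse = S ∧
    {z : ℂ | Polynomial.aeval z S = 0 ∧ ‖z‖ ≠ 1}.ncard = 2

/-- A Salem number: a real number greater than one that is the largest real root of a Salem
polynomial. Degree two is allowed. -/
def IsSalemNumber (x : ℝ) : Prop :=
  1 < x ∧ ∃ S : Polynomial ℤ, IsSalemPolynomial S ∧ IsGreatest {t : ℝ | Polynomial.aeval t S = 0} x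

/-- A two-dimensional complex torus `ℂ² / Λ`, given by a lattice `Λ` in `ℂ²`: a discrete subgroup
that spans `ℂ²` over `ℝ`. -/
structure ComplexTwoTorus where
  lattice : Submodule ℤ (Fin 2 → ℂ)
  discrete : DiscreteTopology lattice
  isZLattice : IsZLattice ℝ lattice

namespace ComplexTwoTorus

/-- The space `ℂ² / Λ` itself. It carries the quotient topology and the uniform structure of the
quotient norm (the distance to the lattice); since the torus is compact and Hausdorff, this is the
only uniform structure that induces its topology. -/
abbrev Point (X : ComplexTwoTorus) : Type := (Fin 2 → ℂ) ⧸ X.lattice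

/-- The covering map `ℂ² → ℂ² / Λ`. Its local inverses are the holomorphic charts of the torus. -/
def proj (X : ComplexTwoTorus) (z : Fin 2 → ℂ) : X.Point := Submodule.Quotient.mk z

/-- A map of complex tori is holomorphic if it is given near every point by a holomorphic map in
the charts that are the local inverses of the covering maps. (`AnalyticAt ℂ g z` says that `g` is
given by a convergent power series, i.e. is holomorphic, in a neighbourhood of `z`.) -/
def IsHolomorphic {X Y : ComplexTwoTorus} (f : X.Point → Y.Point) : Prop :=
  ∀ z : Fin 2 → ℂ, ∃ g : (Fin 2 → ℂ) → (Fin 2 → ℂ),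
    AnalyticAt ℂ g z ∧ ∀ᶠ w in 𝓝 z, f (X.proj w) = Y.proj (g w)

/-- A biholomorphic map: a bijection that is holomorphic in both directions. -/
def IsBiholomorphic {X Y : ComplexTwoTorus} (f : X.Point ≃ Y.Point) : Prop :=
  IsHolomorphic f ∧ IsHolomorphic f.symm

theorem IsHolomorphic.id (X : ComplexTwoTorus) : IsHolomorphic (fun p : X.Point => p) :=
  fun _ => ⟨fun w => w, analyticAt_id, Filter.Eventually.of_forall fun _ => rfl⟩

theorem IsHolomorphic.comp {X Y Z : ComplexTwoTorus} {f : X.Point → Y.Point}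
    {g : Y.Point → Z.Point} (hg : IsHolomorphic g) (hf : IsHolomorphic f) :
    IsHolomorphic (fun p => g (f p)) := by
  intro z
  obtain ⟨F, hF, hF'⟩ := hf z
  obtain ⟨G, hG, hG'⟩ := hg (F z)
  refine ⟨fun w => G (F w), hG.comp hF, ?_⟩
  filter_upwards [hF', hF.continuousAt.eventually hG'] with w h1 h2
  rw [h1, h2]

/-- Two complex tori are isomorphic if there is a biholomorphic map between them. -/
instance isomorphic : Setoid ComplexTwoTorus where
  r X Y := ∃ f : X.Point ≃ Y.Point, IsBiholomorphic f
  iseqv :=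
    { refl := fun X => ⟨Equiv.refl _, IsHolomorphic.id X, IsHolomorphic.id X⟩
      symm := fun ⟨f, h1, h2⟩ => ⟨f.symm, h2, h1⟩
      trans := fun ⟨f, h1, h2⟩ ⟨g, h3, h4⟩ => ⟨f.trans g, h3.comp h1, h2.comp h4⟩ }

/-- The isomorphism class of a complex torus. -/
def isoClass (X : ComplexTwoTorus) : Quotient isomorphic := Quotient.mk isomorphic X

/-- The topological entropy of a self-map of a complex torus. -/
noncomputable def entropy {X : ComplexTwoTorus} (f : X.Point → X.Point) : EReal :=
  Dynamics.coverEntropy f Set.univ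

/-- `X` admits a (biholomorphic) automorphism of topological entropy `h`. The automorphism need
not fix the origin of `ℂ² / Λ`. -/
def AdmitsAutomorphismOfEntropy (X : ComplexTwoTorus) (h : ℝ) : Prop :=
  ∃ f : X.Point ≃ X.Point, IsBiholomorphic f ∧ entropy f = (h : EReal)

end ComplexTwoTorus

/-! An automorphism lifts to an affine map of `ℂ²` whose linear part `A` preserves the lattice
(`IsBiholomorphic.exists_affine`). Comparing volume growth with the entropy shows that the
eigenvalues `α`, `β` of `A` satisfy `‖α‖² = λ` and `‖β‖² = λ⁻¹`
(`AdmitsAutomorphismOfEntropy.exists_eigenvalues`). The characteristic polynomial `P` of `A` on the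
lattice is a monic integral quartic with `P(0) = 1` and roots `α`, `β` and their conjugates.

If `α` or `β` is real, it is a double root, so `P` is the square of some `x² + ax ± 1` with roots
`α`, `β`. Then `λ + λ⁻¹ = α² + β² = a² ∓ 2`, which is the first alternative
(`exists_int_sq_of_root_real`).

Otherwise `P` is irreducible (`minpoly_eq_of_roots_not_real`). Its roots are bounded in terms of
`λ`, so only finitely many `P`, hence finitely many pairs `(α, β)`, occur. For a fixed pair, in
eigencoordinates the lattice is a rank one module over the ring generated by `μ = (α, β)`.
Minkowski's theorem supplies a lattice vector `t` for which the span of the `tμᵏ` has index bounded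
independently of the lattice; rescaling `t` to `(1, 1)` leaves finitely many lattices
(`exists_nat_forall_lattice_smul_mem`, `finite_isoClass_of_eigenvalues`). -/

/-! ### Affine lifts of holomorphic maps -/

theorem exists_pos_forall_mem_norm_lt_eq_zero {E : Type*} [NormedAddCommGroup E]
    (L : Submodule ℤ E) [DiscreteTopology L] :
    ∃ ε > 0, ∀ v ∈ L, ‖v‖ < ε → v = 0 := by
  have h : {(0 : L)} ∈ 𝓝 (0 : L) := by simp
  obtain ⟨ε, hε, h⟩ := Metric.mem_nhds_iff.1 h
  refine ⟨ε, hε, fun v hv hvε => ?_⟩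
  have : (⟨v, hv⟩ : L) ∈ Metric.ball (0 : L) ε := by simpa using hvε
  simpa using h this

/-- A continuous map with values in a discrete subgroup is locally constant. -/
theorem eventually_eq_of_eventually_mem {X E : Type*} [TopologicalSpace X] [NormedAddCommGroup E]
    (L : Submodule ℤ E) [DiscreteTopology L] {h : X → E} {x : X} (hc : ContinuousAt h x)
    (hL : ∀ᶠ y in 𝓝 x, h y ∈ L) : ∀ᶠ y in 𝓝 x, h y = h x := by
  obtain ⟨ε, hε, hd⟩ := exists_pos_forall_mem_norm_lt_eq_zero L
  filter_upwards [hL, Metric.continuousAt_iff'.1 hc ε hε] with y hy hyε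
  rw [dist_eq_norm] at hyε
  exact sub_eq_zero.1 (hd _ (L.sub_mem hy hL.self_of_nhds) hyε)

namespace ComplexTwoTorus

instance (X : ComplexTwoTorus) : DiscreteTopology X.lattice := X.discrete

instance (X : ComplexTwoTorus) : IsZLattice ℝ X.lattice := X.isZLattice

theorem proj_surjective (X : ComplexTwoTorus) : Function.Surjective X.proj :=
  Submodule.Quotient.mk_surjective _

theorem proj_eq_iff (X : ComplexTwoTorus) {v w : Fin 2 → ℂ} :
    X.proj v = X.proj w ↔ v - w ∈ X.lattice := Submodule.Quotient.eq _

@[simp] theorem proj_add (X : ComplexTwoTorus) (v w : Fin 2 → ℂ) :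
    X.proj (v + w) = X.proj v + X.proj w := rfl

@[simp] theorem proj_sub (X : ComplexTwoTorus) (v w : Fin 2 → ℂ) :
    X.proj (v - w) = X.proj v - X.proj w := rfl

@[simp] theorem proj_zero (X : ComplexTwoTorus) : X.proj 0 = 0 := rfl

theorem proj_eq_zero_iff (X : ComplexTwoTorus) {v : Fin 2 → ℂ} : X.proj v = 0 ↔ v ∈ X.lattice :=
  Submodule.Quotient.mk_eq_zero _

theorem norm_proj_le (X : ComplexTwoTorus) (v : Fin 2 → ℂ) : ‖X.proj v‖ ≤ ‖v‖ :=
  QuotientAddGroup.norm_mk_le_norm (S := X.lattice.toAddSubgroup) (m := v)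

theorem norm_proj_lt_iff (X : ComplexTwoTorus) {v : Fin 2 → ℂ} {r : ℝ} :
    ‖X.proj v‖ < r ↔ ∃ w, v - w ∈ X.lattice ∧ ‖w‖ < r := by
  have := QuotientAddGroup.norm_lt_iff (S := X.lattice.toAddSubgroup) (x := X.proj v) (r := r)
  refine this.trans (exists_congr fun w => and_congr_left fun _ => ?_)
  exact Iff.trans ⟨fun h => Eq.symm h, fun h => Eq.symm h⟩ X.proj_eq_iff

/-- Two local lifts differ by a locally constant lattice vector, so the derivative of a lift depends
only on the map of tori. -/
theorem fderiv_eq_of_proj_eventually_eq (X : ComplexTwoTorus) {g g' : (Fin 2 → ℂ) → (Fin 2 → ℂ)}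
    {z : Fin 2 → ℂ} (hg : ContinuousAt g z) (hg' : ContinuousAt g' z)
    (h : ∀ᶠ w in 𝓝 z, X.proj (g w) = X.proj (g' w)) : fderiv ℂ g z = fderiv ℂ g' z := by
  have h1 : ∀ᶠ w in 𝓝 z, g w - g' w ∈ X.lattice := h.mono fun w hw => X.proj_eq_iff.1 hw
  have h2 := eventually_eq_of_eventually_mem X.lattice (h := fun w => g w - g' w)
    (hg.sub hg') h1
  have h3 : g =ᶠ[𝓝 z] fun w => g' w + (g z - g' z) := by
    filter_upwards [h2] with w hw
    rw [← hw]; abel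
  rw [h3.fderiv_eq, fderiv_add_const]

/-- A holomorphic map between complex tori is affine. -/
theorem IsHolomorphic.exists_affine {X Y : ComplexTwoTorus} {f : X.Point → Y.Point}
    (hf : IsHolomorphic f) :
    ∃ A : (Fin 2 → ℂ) →L[ℂ] (Fin 2 → ℂ), ∃ c, ∀ w, f (X.proj w) = Y.proj (A w) + c := by
  choose g hga hgf using hf
  -- The derivatives of the local lifts glue to one entire function `D`. It is periodic, hence
  -- bounded, hence constant by Liouville.
  set D : (Fin 2 → ℂ) → (Fin 2 → ℂ) →L[ℂ] (Fin 2 → ℂ) := fun z => fderiv ℂ (g z) z with hD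
  have hloc : ∀ z, ∀ᶠ w in 𝓝 z, D w = fderiv ℂ (g z) w := by
    intro z
    filter_upwards [(hga z).eventually_analyticAt, (hgf z).eventually_nhds] with w hw hw'
    refine Y.fderiv_eq_of_proj_eventually_eq (hga w).continuousAt hw.continuousAt ?_
    filter_upwards [hw', hgf w] with u hu hu'
    rw [← hu, hu']
  have hdiff : Differentiable ℂ D := fun z =>
    ((hga z).fderiv.differentiableAt).congr_of_eventuallyEq (hloc z)
  have hper : ∀ z l, l ∈ X.lattice → D (z + l) = D z := by
    intro z l hl
    have h1 : fderiv ℂ (fun w => g (z + l) (w + l)) z = D (z + l) :=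
      fderiv_comp_add_right (f := g (z + l)) l
    rw [← h1]
    have hc : ContinuousAt (fun w : Fin 2 → ℂ => w + l) z := by fun_prop
    refine Y.fderiv_eq_of_proj_eventually_eq
      (ContinuousAt.comp (f := fun w => w + l) (hga (z + l)).continuousAt hc)
      (hga z).continuousAt ?_
    filter_upwards [hc.eventually (hgf (z + l)), hgf z] with w hw hw'
    rw [← hw, ← hw', proj_add, X.proj_eq_zero_iff.2 hl, add_zero]
  have hb : Bornology.IsBounded (Set.range D) :=
    (IsZLattice.isCompact_range_of_periodic X.lattice D hdiff.continuous hper).isBounded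
  obtain ⟨A, hA⟩ := hdiff.exists_eq_const_of_bounded hb
  refine ⟨A, f 0, fun w => ?_⟩
  have hlc : IsLocallyConstant fun w => f (X.proj w) - Y.proj (A w) := by
    rw [IsLocallyConstant.iff_eventually_eq]
    intro z
    obtain ⟨r, hr, hball⟩ := Metric.eventually_nhds_iff_ball.1
      (((hga z).eventually_analyticAt.and (hgf z)).and (hloc z))
    filter_upwards [Metric.ball_mem_nhds z hr] with w hw
    have hcst : g z w - A w = g z z - A z := by
      refine (convex_ball z r).is_const_of_fderivWithin_eq_zero (𝕜 := ℂ)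
        (f := fun u => g z u - A u) (fun u hu => ?_) (fun u hu => ?_) hw (Metric.mem_ball_self hr)
      · exact ((hball u hu).1.1.differentiableAt.sub
          A.differentiableAt).differentiableWithinAt
      · rw [fderivWithin_of_isOpen Metric.isOpen_ball hu,
          fderiv_fun_sub (hball u hu).1.1.differentiableAt A.differentiableAt,
          ← (hball u hu).2, hA, A.fderiv]
        simp
    rw [(hball w hw).1.2, (hball z (Metric.mem_ball_self hr)).1.2, ← proj_sub, hcst, proj_sub]
  have := hlc.apply_eq_of_preconnectedSpace w 0
  simp only [map_zero, proj_zero, sub_zero] at this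
  rw [← this]; abel

theorem map_mem_lattice_of_affine {X Y : ComplexTwoTorus} {f : X.Point → Y.Point}
    {A : (Fin 2 → ℂ) →L[ℂ] (Fin 2 → ℂ)} {c : Y.Point} (h : ∀ w, f (X.proj w) = Y.proj (A w) + c)
    {v : Fin 2 → ℂ} (hv : v ∈ X.lattice) : A v ∈ Y.lattice := by
  have h0 := h 0
  have h1 := h v
  rw [X.proj_eq_zero_iff.2 hv] at h1
  rw [proj_zero, h1, map_zero, proj_zero] at h0
  exact Y.proj_eq_zero_iff.1 (add_right_cancel h0)

theorem eq_zero_of_forall_mem_lattice (X : ComplexTwoTorus)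
    (A : (Fin 2 → ℂ) →L[ℂ] (Fin 2 → ℂ)) (h : ∀ v, A v ∈ X.lattice) : A = 0 := by
  have hlc : IsLocallyConstant A := by
    rw [IsLocallyConstant.iff_eventually_eq]
    exact fun z => eventually_eq_of_eventually_mem X.lattice A.continuous.continuousAt
      (Filter.Eventually.of_forall h)
  ext1 v
  simpa using hlc.apply_eq_of_preconnectedSpace v 0

/-- A biholomorphic self-map of a complex torus lifts to an affine map whose linear part restricts
to an automorphism of the lattice. -/
theorem IsBiholomorphic.exists_affine {X : ComplexTwoTorus} {f : X.Point ≃ X.Point}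
    (hf : IsBiholomorphic f) :
    ∃ A B : (Fin 2 → ℂ) →L[ℂ] (Fin 2 → ℂ), B ∘L A = 1 ∧ (∀ v ∈ X.lattice, A v ∈ X.lattice) ∧
      (∀ v ∈ X.lattice, B v ∈ X.lattice) ∧ ∃ c, ∀ w, f (X.proj w) = X.proj (A w) + c := by
  obtain ⟨A, c, hA⟩ := hf.1.exists_affine
  obtain ⟨B, d, hB⟩ := hf.2.exists_affine
  refine ⟨A, B, ?_, fun v => map_mem_lattice_of_affine hA, fun v => map_mem_lattice_of_affine hB,
    c, hA⟩
  rw [← sub_eq_zero]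
  -- `f.symm ∘ f = id` gives `B ∘ A = 1` only modulo the lattice; a linear map with values in a
  -- discrete group vanishes.
  refine X.eq_zero_of_forall_mem_lattice _ fun v => ?_
  obtain ⟨c, rfl⟩ := X.proj_surjective c
  have key : ∀ w, X.proj w = X.proj (B (A w)) + X.proj (B c) + d := by
    intro w
    rw [← f.symm_apply_apply (X.proj w), hA, ← proj_add, hB, map_add, proj_add]
  have h0 := key 0
  have hv := key v
  simp only [map_zero, proj_zero, zero_add, add_assoc] at h0 hv
  rw [← h0, add_zero] at hv
  exact X.proj_eq_iff.1 hv.symm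

theorem isoClass_eq_of_linearEquiv {X Y : ComplexTwoTorus} (T : (Fin 2 → ℂ) ≃L[ℂ] (Fin 2 → ℂ))
    (h : ∀ v, T v ∈ Y.lattice ↔ v ∈ X.lattice) : X.isoClass = Y.isoClass := by
  refine Quotient.sound ?_
  let e : X.Point ≃+ Y.Point :=
    (Submodule.Quotient.equiv X.lattice Y.lattice
      (T.toLinearEquiv.toAddEquiv.toIntLinearEquiv) (by
        ext v
        rw [Submodule.mem_map]
        constructor
        · rintro ⟨w, hw, rfl⟩
          exact (h w).2 hw
        · intro hv
          exact ⟨T.symm v, (h _).1 (by simpa using hv), T.apply_symm_apply v⟩)).toAddEquiv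
  have he : ∀ v, e (X.proj v) = Y.proj (T v) := fun v => rfl
  refine ⟨e.toEquiv, fun z => ⟨T, T.toContinuousLinearMap.analyticAt z,
    Filter.Eventually.of_forall fun w => he w⟩, fun z => ⟨T.symm,
    T.symm.toContinuousLinearMap.analyticAt z, Filter.Eventually.of_forall fun w => ?_⟩⟩
  refine e.symm_apply_eq.2 ?_
  rw [he, T.apply_symm_apply]

end ComplexTwoTorus

/-! ### Entropy of affine maps -/

/-- A disc in the complex plane is covered by a square grid of controlled cardinality. -/
theorem Complex.exists_finset_forall_norm_sub_le {R s : ℝ} (hR : 0 ≤ R) (hs : 0 < s) (hs1 : s ≤ 1) :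
    ∃ G : Finset ℂ, (G.card : ℝ) ≤ ((4 * R + 5) / s) ^ 2 ∧
      ∀ z : ℂ, ‖z‖ ≤ R → ∃ g ∈ G, ‖z - g‖ ≤ s := by
  classical
  -- Mesh `s / 2` in each real direction makes the two errors add up to at most `s`.
  set N : ℕ := ⌈R / (s / 2)⌉₊ with hN
  set I : Finset ℤ := Finset.Icc (-(N : ℤ)) N with hI
  refine ⟨(I ×ˢ I).image fun p => ⟨s / 2 * p.1, s / 2 * p.2⟩, ?_, fun z hz => ?_⟩
  · have h1 : ((I ×ˢ I).image fun p : ℤ × ℤ => (⟨s / 2 * p.1, s / 2 * p.2⟩ : ℂ)).card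
        ≤ (2 * N + 1) ^ 2 := by
      refine Finset.card_image_le.trans (le_of_eq ?_)
      rw [Finset.card_product, hI, Int.card_Icc, sq]
      congr 1 <;> omega
    have h2 : (N : ℝ) ≤ R / (s / 2) + 1 := (Nat.ceil_lt_add_one (by positivity)).le
    calc (_ : ℝ) ≤ ((2 * N + 1 : ℕ) : ℝ) ^ 2 := by exact_mod_cast h1
      _ ≤ ((4 * R + 5) / s) ^ 2 := by
        gcongr
        push_cast
        rw [le_div_iff₀ hs]
        have h3 : (R / (s / 2) + 1) * s = 2 * R + s := by field_simp
        nlinarith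
  · have key : ∀ x : ℝ, |x| ≤ R → ⌊x / (s / 2)⌋ ∈ I ∧ |x - s / 2 * ⌊x / (s / 2)⌋| ≤ s / 2 := by
      intro x hx
      have hNR : R / (s / 2) ≤ N := Nat.le_ceil _
      have h1 : |x / (s / 2)| ≤ N := by
        rw [abs_div, abs_of_pos (half_pos hs)]
        exact (div_le_div_of_nonneg_right hx (half_pos hs).le).trans hNR
      obtain ⟨h2, h3⟩ := abs_le.1 h1
      refine ⟨Finset.mem_Icc.2 ⟨Int.le_floor.2 (by push_cast; exact h2), ?_⟩, ?_⟩
      · exact_mod_cast (Int.floor_le _).trans h3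
      · have h4 : x = s / 2 * (x / (s / 2)) := by field_simp
        have h5 : x - s / 2 * ⌊x / (s / 2)⌋ = s / 2 * Int.fract (x / (s / 2)) := by
          rw [Int.fract]; linear_combination h4
        rw [h5, abs_of_nonneg (mul_nonneg (half_pos hs).le (Int.fract_nonneg _))]
        exact mul_le_of_le_one_right (half_pos hs).le (Int.fract_lt_one _).le
    obtain ⟨h1, h2⟩ := key z.re ((Complex.abs_re_le_norm z).trans hz)
    obtain ⟨h3, h4⟩ := key z.im ((Complex.abs_im_le_norm z).trans hz)
    refine ⟨_, Finset.mem_image_of_mem _ (Finset.mk_mem_product h1 h3), ?_⟩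
    refine (Complex.norm_le_abs_re_add_abs_im _).trans ?_
    simp only [Complex.sub_re, Complex.sub_im]
    linarith

namespace ComplexTwoTorus

variable {X : ComplexTwoTorus} {f : X.Point → X.Point} {A : (Fin 2 → ℂ) →L[ℂ] (Fin 2 → ℂ)}
  {c : X.Point}

theorem dist_iterate_proj (hf : ∀ w, f (X.proj w) = X.proj (A w) + c) (k : ℕ) (v w : Fin 2 → ℂ) :
    dist (f^[k] (X.proj v)) (f^[k] (X.proj w)) = ‖X.proj ((A ^ k) (v - w))‖ := by
  induction k generalizing v w with
  | zero => rw [dist_eq_norm]; simp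
  | succ k ih =>
    obtain ⟨d, rfl⟩ := X.proj_surjective c
    rw [Function.iterate_succ_apply, Function.iterate_succ_apply, hf, hf, ← proj_add, ← proj_add,
      ih, pow_succ, add_sub_add_right_eq_sub, ← map_sub]
    rfl

theorem exists_norm_apply_le (X : ComplexTwoTorus) (L : (Fin 2 → ℂ) ≃L[ℂ] (Fin 2 → ℂ)) :
    ∃ R ≥ 0, ∀ x : X.Point, ∃ v, X.proj v = x ∧ ∀ i, ‖L v i‖ ≤ R := by
  have := ZLattice.module_free ℝ X.lattice
  let b := (Module.Free.chooseBasis ℤ X.lattice).ofZLatticeBasis ℝ X.lattice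
  refine ⟨‖L.toContinuousLinearMap‖ * ∑ i, ‖b i‖, by positivity, fun x => ?_⟩
  obtain ⟨w, rfl⟩ := X.proj_surjective x
  refine ⟨ZSpan.fract b w, ?_, fun i => ?_⟩
  · rw [proj_eq_iff, ZSpan.fract_apply, sub_sub_cancel_left, neg_mem_iff]
    exact (Module.Basis.ofZLatticeBasis_span ℝ X.lattice _).le (ZSpan.floor b w).2
  · refine (norm_le_pi_norm _ i).trans ((L.toContinuousLinearMap.le_opNorm _).trans ?_)
    gcongr
    exact ZSpan.norm_fract_le b w

/-- The hypothesis says that polydiscs of radii `s` in the coordinates `L` stay `ε`-small for `n`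
steps. A bounded polydisc maps onto the torus, and a grid adapted to `s` covers it with `O(∏ s i ^
(-2))` such pieces, the square coming from complex coordinates. -/
theorem entropy_le_log_of_forall_exists (hf : ∀ w, f (X.proj w) = X.proj (A w) + c)
    (L : (Fin 2 → ℂ) ≃L[ℂ] (Fin 2 → ℂ)) {ρ : ℝ} (hρ : 0 < ρ)
    (h : ∀ ε > 0, ∃ C : ℝ, ∀ n : ℕ, ∃ s : Fin 2 → ℝ, (∀ i, 0 < s i ∧ s i ≤ 1) ∧
      (∀ v, (∀ i, ‖L v i‖ ≤ s i) → ∀ k < n, ‖(A ^ k) v‖ < ε) ∧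
      ((s 0)⁻¹ * (s 1)⁻¹) ^ 2 ≤ C * ρ ^ n) :
    entropy f ≤ (Real.log ρ : EReal) := by
  classical
  obtain ⟨R, hR, hRX⟩ := X.exists_norm_apply_le L
  rw [entropy, Dynamics.coverEntropy_eq_iSup_basis Metric.uniformity_basis_dist]
  refine iSup₂_le fun ε hε => ?_
  obtain ⟨C, hC⟩ := h ε hε
  rw [← ENNReal.log_ofReal_of_pos hρ, ← ExpGrowth.expGrowthSup_pow]
  refine ExpGrowth.expGrowthSup_le_of_eventually_le
    (b := ENNReal.ofReal ((4 * R + 5) ^ 4 * C)) ENNReal.ofReal_ne_top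
    (Filter.Eventually.of_forall fun n => ?_)
  obtain ⟨s, hs, hsv, hsC⟩ := hC n
  choose G hGc hG using fun i => Complex.exists_finset_forall_norm_sub_le hR (hs i).1 (hs i).2
  set S : Finset X.Point := (Fintype.piFinset G).image fun g => X.proj (L.symm g) with hS
  have hcov : Dynamics.IsDynCoverOf f Set.univ {p : X.Point × X.Point | dist p.1 p.2 < ε} n
      (S : Set X.Point) := by
    intro x _
    obtain ⟨v, rfl, hv⟩ := hRX x
    choose g hgG hg using fun i => hG i (L v i) (hv i)
    refine ⟨X.proj (L.symm g), ?_, ?_⟩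
    · exact Finset.mem_coe.2 (Finset.mem_image_of_mem _ (Fintype.mem_piFinset.2 hgG))
    · rw [Dynamics.mem_dynEntourage]
      intro k hk
      rw [Set.mem_ofPred_eq, dist_iterate_proj hf]
      refine (X.norm_proj_le _).trans_lt (hsv _ (fun i => ?_) k hk)
      rw [map_sub, L.apply_symm_apply]
      exact hg i
  have hcard : (S.card : ℝ) ≤ (4 * R + 5) ^ 4 * C * ρ ^ n := by
    calc (S.card : ℝ) ≤ ((∏ i, (G i).card : ℕ) : ℝ) := by
          exact_mod_cast Finset.card_image_le.trans (Fintype.card_piFinset G).le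
      _ = (G 0).card * (G 1).card := by simp
      _ ≤ ((4 * R + 5) / s 0) ^ 2 * ((4 * R + 5) / s 1) ^ 2 := by
          gcongr
          · exact hGc 0
          · exact hGc 1
      _ = (4 * R + 5) ^ 4 * ((s 0)⁻¹ * (s 1)⁻¹) ^ 2 := by
          simp only [div_eq_mul_inv]; ring
      _ ≤ (4 * R + 5) ^ 4 * (C * ρ ^ n) := by gcongr
      _ = _ := by ring
  calc ((Dynamics.coverMincard f Set.univ _ n : ℕ∞) : ENNReal) ≤ ((S.card : ℕ∞) : ENNReal) :=
        ENat.toENNReal_le.2 hcov.coverMincard_le_card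
    _ = ENNReal.ofReal S.card := by simp
    _ ≤ ENNReal.ofReal ((4 * R + 5) ^ 4 * C * ρ ^ n) := ENNReal.ofReal_le_ofReal hcard
    _ = _ := by rw [ENNReal.ofReal_mul' (by positivity), ENNReal.ofReal_pow hρ.le]

/-- Only the expanding coordinate needs a finer grid: radii `δ / ‖μ 0‖ ^ n` and `δ` suffice for all
times below `n`. -/
theorem entropy_le_of_diagonal (hf : ∀ w, f (X.proj w) = X.proj (A w) + c)
    (L : (Fin 2 → ℂ) ≃L[ℂ] (Fin 2 → ℂ)) {μ : Fin 2 → ℂ} (hL : ∀ v i, L (A v) i = μ i * L v i)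
    (h0 : 1 ≤ ‖μ 0‖) (h1 : ‖μ 1‖ ≤ 1) : entropy f ≤ (Real.log (‖μ 0‖ ^ 2) : EReal) := by
  have hLk : ∀ (k : ℕ) v i, L ((A ^ k) v) i = μ i ^ k * L v i := by
    intro k
    induction k with
    | zero => simp
    | succ k ih =>
      intro v i
      rw [pow_succ, mul_apply_eq_comp, ih, hL]; ring
  have hpos : 0 < ‖μ 0‖ := by linarith
  refine entropy_le_log_of_forall_exists hf L (by positivity) fun ε hε => ?_
  set M : ℝ := ‖L.symm.toContinuousLinearMap‖ + 1 with hM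
  have hMpos : 0 < M := by positivity
  set δ : ℝ := min 1 (ε / (2 * M)) with hδ
  have hδ0 : 0 < δ := lt_min one_pos (by positivity)
  have hδM : M * δ < ε := by
    calc M * δ ≤ M * (ε / (2 * M)) := by gcongr; exact min_le_right _ _
      _ = ε / 2 := by field_simp
      _ < ε := by linarith
  refine ⟨(δ⁻¹ * δ⁻¹) ^ 2, fun n => ⟨![δ / ‖μ 0‖ ^ n, δ], ?_, ?_, ?_⟩⟩
  · intro i
    fin_cases i
    · refine ⟨by simp; positivity, ?_⟩
      simp only [Fin.zero_eta, Matrix.cons_val_zero]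
      exact (div_le_self hδ0.le (one_le_pow₀ h0)).trans (min_le_left _ _)
    · exact ⟨by simpa, by simp [hδ]⟩
  · intro v hv k hk
    have hbd : ∀ i, ‖L ((A ^ k) v) i‖ ≤ δ := by
      intro i
      rw [hLk, norm_mul, norm_pow]
      have hvi := hv i
      fin_cases i
      · simp only [Fin.zero_eta, Matrix.cons_val_zero] at hvi ⊢
        calc ‖μ 0‖ ^ k * ‖L v 0‖ ≤ ‖μ 0‖ ^ n * (δ / ‖μ 0‖ ^ n) := by gcongr
          _ = δ := by field_simp
      · simp only [Fin.mk_one, Matrix.cons_val_one, Matrix.cons_val_fin_one] at hvi ⊢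
        calc ‖μ 1‖ ^ k * ‖L v 1‖ ≤ 1 * δ := by gcongr; exact pow_le_one₀ (norm_nonneg _) h1
          _ = δ := one_mul _
    calc ‖(A ^ k) v‖ = ‖L.symm.toContinuousLinearMap (L ((A ^ k) v))‖ := by simp
      _ ≤ ‖L.symm.toContinuousLinearMap‖ * ‖L ((A ^ k) v)‖ := ContinuousLinearMap.le_opNorm _ _
      _ ≤ M * δ := by
        gcongr
        · linarith
        · exact (pi_norm_le_iff_of_nonneg hδ0.le).2 hbd
      _ < ε := hδM
  · simp only [Matrix.cons_val_zero, Matrix.cons_val_one, Matrix.cons_val_fin_one]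
    apply le_of_eq
    field_simp
    ring

/-- Equal radii `δ / r ^ n` in both coordinates; the exponent 4 is the real dimension. This crude
bound requires no diagonalization and serves to exclude eigenvalues on the unit circle. -/
theorem entropy_le_of_norm_pow_le (hf : ∀ w, f (X.proj w) = X.proj (A w) + c) {C r : ℝ}
    (hC : 0 < C) (hr : 1 ≤ r) (h : ∀ k, ‖A ^ k‖ ≤ C * r ^ k) :
    entropy f ≤ (Real.log (r ^ 4) : EReal) := by
  have hr0 : 0 < r := by linarith
  refine entropy_le_log_of_forall_exists hf (ContinuousLinearEquiv.refl ℂ _) (by positivity)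
    fun ε hε => ?_
  set δ : ℝ := min 1 (ε / (2 * C)) with hδ
  have hδ0 : 0 < δ := lt_min one_pos (by positivity)
  have hδC : C * δ < ε := by
    calc C * δ ≤ C * (ε / (2 * C)) := by gcongr; exact min_le_right _ _
      _ = ε / 2 := by field_simp
      _ < ε := by linarith
  refine ⟨(δ⁻¹ * δ⁻¹) ^ 2, fun n => ⟨fun _ => δ / r ^ n, fun _ => ⟨by positivity, ?_⟩, ?_, ?_⟩⟩
  · exact (div_le_self hδ0.le (one_le_pow₀ hr)).trans (min_le_left _ _)
  · intro v hv k hk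
    have hvn : ‖v‖ ≤ δ / r ^ n := (pi_norm_le_iff_of_nonneg (by positivity)).2 hv
    calc ‖(A ^ k) v‖ ≤ ‖A ^ k‖ * ‖v‖ := ContinuousLinearMap.le_opNorm _ _
      _ ≤ (C * r ^ n) * (δ / r ^ n) := by
        gcongr
        exact (h k).trans (by gcongr)
      _ = C * δ := by field_simp
      _ < ε := hδC
  · apply le_of_eq
    field_simp
    ring

/-- At small scale the torus distance is the distance upstairs. Inductively, `A ^ (k + 1) v` and its
short representative differ by a lattice vector of norm below `(‖A‖ + 1) η ≤ ε`, which is therefore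
zero. -/
theorem norm_pow_apply_lt_of_norm_proj_lt {η ε : ℝ} (hε : ∀ v ∈ X.lattice, ‖v‖ < ε → v = 0)
    (hη : (‖A‖ + 1) * η ≤ ε) {v : Fin 2 → ℂ} (hv : ‖v‖ < η) {n : ℕ}
    (h : ∀ k < n, ‖X.proj ((A ^ k) v)‖ < η) : ∀ k < n, ‖(A ^ k) v‖ < η := by
  intro k hk
  induction k with
  | zero => simpa
  | succ k ih =>
    have ih := ih (by omega)
    obtain ⟨w, hw, hwη⟩ := X.norm_proj_lt_iff.1 (h (k + 1) hk)
    have hA : ‖(A ^ (k + 1)) v‖ ≤ ‖A‖ * η := by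
      rw [pow_succ', mul_apply_eq_comp]
      exact (A.le_opNorm _).trans (by gcongr)
    have := hε _ hw ((norm_sub_le _ _).trans_lt (by linarith))
    rwa [sub_eq_zero.1 this]

/-- On the complex line through `u` the map expands by `‖α‖`, so a square grid of spacing of order
`‖α‖ ^ (-n)` provides about `‖α‖ ^ (2 n)` points that separate within `n` steps. -/
theorem log_le_entropy_of_eigenvector (hf : ∀ w, f (X.proj w) = X.proj (A w) + c)
    {α : ℂ} (hα : 1 < ‖α‖) {u : Fin 2 → ℂ} (hu : A u = α • u) (hu0 : u ≠ 0) :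
    (Real.log (‖α‖ ^ 2) : EReal) ≤ entropy f := by
  classical
  have hα0 : 0 < ‖α‖ := by linarith
  wlog hu1 : ‖u‖ = 1 generalizing u
  · refine this (u := ((‖u‖ : ℂ)⁻¹) • u) ?_ ?_ ?_
    · rw [map_smul, hu, smul_comm]
    · simpa using hu0
    · rw [norm_smul]; simp [hu0]
  have hAk : ∀ k : ℕ, ∀ z : ℂ, (A ^ k) (z • u) = (α ^ k * z) • u := by
    intro k
    induction k with
    | zero => simp
    | succ k ih =>
      intro z
      rw [pow_succ, mul_apply_eq_comp, map_smul, hu, smul_smul, ih]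
      congr 1; ring
  obtain ⟨ε, hε, hεX⟩ := exists_pos_forall_mem_norm_lt_eq_zero X.lattice
  set η : ℝ := ε / (‖A‖ + 1) with hη
  have hη0 : 0 < η := by positivity
  have hηA : (‖A‖ + 1) * η ≤ ε := by rw [hη]; apply le_of_eq; field_simp
  refine le_trans ?_ (Dynamics.netEntropyEntourage_le_coverEntropy f Set.univ
    (Metric.dist_mem_uniformity (half_pos hη0)))
  rw [← ENNReal.log_ofReal_of_pos (by positivity), ← ExpGrowth.expGrowthSup_pow]
  refine ExpGrowth.expGrowthSup_of_eventually_ge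
    (b := ENNReal.ofReal ((16 * ‖α‖ ^ 2)⁻¹)) (ENNReal.ofReal_pos.2 (by positivity)).ne' ?_
  filter_upwards [(tendsto_pow_atTop_atTop_of_one_lt hα).eventually_ge_atTop (4 * ‖α‖),
    Filter.eventually_ge_atTop 1] with n hn hn1
  -- The spacing `s` equals `η / ‖α‖ ^ (n - 1)`, so distinct grid points are `η` apart by the last
  -- time `n - 1`; `m` keeps the grid of diameter below `η`. The condition `4 * ‖α‖ ≤ ‖α‖ ^ n` makes
  -- the floor at least half its argument.
  set m : ℕ := ⌊‖α‖ ^ n / (2 * ‖α‖)⌋₊ with hm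
  set s : ℝ := η * ‖α‖ / ‖α‖ ^ n with hs
  have hs0 : 0 < s := by positivity
  have hms : 2 * s * m ≤ η := by
    have : (m : ℝ) ≤ ‖α‖ ^ n / (2 * ‖α‖) := Nat.floor_le (by positivity)
    calc 2 * s * m ≤ 2 * s * (‖α‖ ^ n / (2 * ‖α‖)) := by gcongr
      _ = η := by rw [hs]; field_simp
  have hm' : ‖α‖ ^ n / (4 * ‖α‖) ≤ m := by
    have h1 : ‖α‖ ^ n / (2 * ‖α‖) < m + 1 := Nat.lt_floor_add_one _
    have h2 : ‖α‖ ^ n / (2 * ‖α‖) = 2 * (‖α‖ ^ n / (4 * ‖α‖)) := by field_simp; norm_num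
    have h3 : 1 ≤ ‖α‖ ^ n / (4 * ‖α‖) := by rwa [le_div_iff₀ (by positivity), one_mul]
    linarith
  let q : ℕ × ℕ → ℂ := fun p => ⟨s * p.1, s * p.2⟩
  let pt : ℕ × ℕ → X.Point := fun p => X.proj (q p • u)
  set I : Finset (ℕ × ℕ) := Finset.range m ×ˢ Finset.range m with hI
  have hsep : ∀ p ∈ I, ∀ p' ∈ I, (∀ k < n, dist (f^[k] (pt p)) (f^[k] (pt p')) < η) → p = p' := by
    intro p hp p' hp' h
    simp only [hI, Finset.mem_product, Finset.mem_range] at hp hp'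
    have hsub : q p • u - q p' • u = (q p - q p') • u := (sub_smul _ _ _).symm
    have hco : ∀ a b : ℕ, a < m → b < m → |s * a - s * b| < η / 2 := by
      intro a b ha hb
      have ha' : (a : ℝ) < m := by exact_mod_cast ha
      have hb' : (b : ℝ) < m := by exact_mod_cast hb
      have h1 : s * a < s * m := by gcongr
      have h2 : s * b < s * m := by gcongr
      have h3 : 0 ≤ s * a := by positivity
      have h4 : 0 ≤ s * b := by positivity
      rw [abs_lt]; constructor <;> linarith
    have hq : ‖q p - q p'‖ < η := by
      refine (Complex.norm_le_abs_re_add_abs_im _).trans_lt ?_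
      have h1 := hco p.1 p'.1 hp.1 hp'.1
      have h2 := hco p.2 p'.2 hp.2 hp'.2
      simp only [q, Complex.sub_re, Complex.sub_im]
      linarith
    have hlt := norm_pow_apply_lt_of_norm_proj_lt (A := A) hεX hηA
      (v := (q p - q p') • u) (by rwa [norm_smul, hu1, mul_one]) (n := n) (fun k hk => by
        rw [← hsub, ← dist_iterate_proj hf]; exact h k hk) (n - 1) (by omega)
    rw [hAk, norm_smul, hu1, mul_one, norm_mul, norm_pow] at hlt
    have hqs : ‖q p - q p'‖ < s := by
      have h1 : ‖α‖ ^ n = ‖α‖ ^ (n - 1) * ‖α‖ := by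
        rw [← pow_succ]; congr 1; omega
      have h2 : s = η / ‖α‖ ^ (n - 1) := by rw [hs, h1]; field_simp
      rw [h2, lt_div_iff₀ (by positivity)]
      linarith
    have hint : ∀ a b : ℕ, |s * a - s * b| < s → a = b := by
      intro a b hab
      rw [← mul_sub, abs_mul, abs_of_pos hs0] at hab
      have h1 : |(a : ℝ) - b| < 1 := by
        by_contra! h2
        nlinarith
      have h2 : |(a : ℤ) - b| < 1 := by exact_mod_cast h1
      have := Int.abs_lt_one_iff.1 h2
      omega
    refine Prod.ext (hint _ _ ?_) (hint _ _ ?_)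
    · exact (Complex.abs_re_le_norm (q p - q p')).trans_lt hqs
    · exact (Complex.abs_im_le_norm (q p - q p')).trans_lt hqs
  have hinj : Set.InjOn pt I := fun p hp p' hp' h =>
    hsep p hp p' hp' fun k _ => by rw [h, dist_self]; exact hη0
  have hnet : Dynamics.IsDynNetIn f Set.univ {p : X.Point × X.Point | dist p.1 p.2 < η / 2} n
      ((I.image pt : Finset X.Point) : Set X.Point) := by
    refine ⟨Set.subset_univ _, ?_⟩
    rw [Finset.coe_image]
    rintro _ ⟨p, hp, rfl⟩ _ ⟨p', hp', rfl⟩ hne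
    refine Set.disjoint_left.2 fun z hz hz' => hne ?_
    rw [Dynamics.mem_ball_dynEntourage] at hz hz'
    refine congrArg pt (hsep p hp p' hp' fun k hk => ?_)
    have h1 : dist (f^[k] (pt p)) (f^[k] z) < η / 2 := hz k hk
    have h2 : dist (f^[k] (pt p')) (f^[k] z) < η / 2 := hz' k hk
    linarith [dist_triangle_right (f^[k] (pt p)) (f^[k] (pt p')) (f^[k] z)]
  have hcard : (I.image pt).card = m * m := by
    rw [Finset.card_image_of_injOn hinj, hI, Finset.card_product, Finset.card_range]
  calc ENNReal.ofReal ((16 * ‖α‖ ^ 2)⁻¹) * ENNReal.ofReal (‖α‖ ^ 2) ^ n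
      = ENNReal.ofReal ((16 * ‖α‖ ^ 2)⁻¹ * (‖α‖ ^ 2) ^ n) := by
        rw [ENNReal.ofReal_mul (by positivity), ENNReal.ofReal_pow (p := ‖α‖ ^ 2) (by positivity)]
    _ ≤ ENNReal.ofReal ((m * m : ℕ) : ℝ) := by
        refine ENNReal.ofReal_le_ofReal ?_
        calc (16 * ‖α‖ ^ 2)⁻¹ * (‖α‖ ^ 2) ^ n
            = (‖α‖ ^ n / (4 * ‖α‖)) * (‖α‖ ^ n / (4 * ‖α‖)) := by
              field_simp; ring
          _ ≤ ((m * m : ℕ) : ℝ) := by push_cast; gcongr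
    _ = (((I.image pt).card : ℕ∞) : ENNReal) := by rw [hcard]; simp
    _ ≤ _ := ENat.toENNReal_le.2 hnet.card_le_netMaxcard

end ComplexTwoTorus

/-! ### The integral characteristic polynomial and its factorization -/

open Polynomial ComplexConjugate in
theorem Polynomial.eq_of_forall_eval_ofReal_eq {p q : ℂ[X]}
    (h : ∀ t : ℝ, p.eval (t : ℂ) = q.eval (t : ℂ)) : p = q := by
  refine Polynomial.eq_of_infinite_eval_eq p q ?_
  refine (Set.infinite_range_of_injective Complex.ofReal_injective).mono ?_
  rintro _ ⟨t, rfl⟩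
  exact h t

open Polynomial ComplexConjugate in
theorem Polynomial.aeval_conj_int (P : ℤ[X]) (z : ℂ) : aeval (conj z) P = conj (aeval z P) :=
  Polynomial.aeval_algHom_apply ((Complex.conjAe.toAlgHom).restrictScalars ℤ) z P

namespace ComplexTwoTorus

open Polynomial ComplexConjugate

/-- The characteristic polynomial of the action on the lattice. -/
theorem exists_int_charpoly (X : ComplexTwoTorus) {A : (Fin 2 → ℂ) →L[ℂ] (Fin 2 → ℂ)}
    (hA : ∀ v ∈ X.lattice, A v ∈ X.lattice) :
    ∃ P : ℤ[X], P.Monic ∧ P.natDegree = 4 ∧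
      ∀ t : ℝ, aeval t P = Complex.normSq (A.toLinearMap.charpoly.eval (t : ℂ)) := by
  classical
  have := ZLattice.module_free ℝ X.lattice
  have := ZLattice.module_finite ℝ X.lattice
  let AZ : X.lattice →ₗ[ℤ] X.lattice := (A.toLinearMap.restrictScalars ℤ).restrict hA
  let AR : (Fin 2 → ℂ) →ₗ[ℝ] (Fin 2 → ℂ) := A.toLinearMap.restrictScalars ℝ
  let b := Module.Free.chooseBasis ℤ X.lattice
  let bR := b.ofZLatticeBasis ℝ X.lattice
  -- A `ℤ`-basis of the lattice is an `ℝ`-basis of `ℂ²`, so both maps have the same matrix.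
  have hmap : AZ.charpoly.map (Int.castRingHom ℝ) = AR.charpoly := by
    rw [← LinearMap.charpoly_toMatrix AZ b, ← LinearMap.charpoly_toMatrix AR bR,
      ← Matrix.charpoly_map]
    congr 1
    ext i j
    rw [Matrix.map_apply, LinearMap.toMatrix_apply, LinearMap.toMatrix_apply]
    have h1 : AR (bR j) = (AZ (b j) : X.lattice) := by
      simp only [bR, Module.Basis.ofZLatticeBasis_apply]
      rfl
    rw [h1, Module.Basis.ofZLatticeBasis_repr_apply]
    rfl
  refine ⟨AZ.charpoly, LinearMap.charpoly_monic _, ?_, fun t => ?_⟩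
  · rw [LinearMap.charpoly_natDegree, ZLattice.rank ℝ X.lattice]
    simp [Module.finrank_pi_fintype, Complex.finrank_real_complex]
  · have h1 : aeval t AZ.charpoly = AR.charpoly.eval t := by
      rw [← hmap, aeval_def, eval_map]; rfl
    rw [h1, LinearMap.eval_charpoly, LinearMap.eval_charpoly, ← Algebra.norm_complex_apply,
      ← LinearMap.det_restrictScalars]
    congr 1

end ComplexTwoTorus

open Polynomial ComplexConjugate in
theorem eval_and_natDegree_and_coeff_zero_of_roots {P : ℤ[X]} (hP : P.Monic) {γ δ : ℂ}
    (h : P.map (Int.castRingHom ℂ) =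
      (X - C γ) * (X - C δ) * ((X - C (conj γ)) * (X - C (conj δ))))
    (hγδ : ‖γ‖ * ‖δ‖ = 1) :
    (∀ z : ℂ, aeval z P = (z - γ) * (z - δ) * ((z - conj γ) * (z - conj δ))) ∧
      P.natDegree = 4 ∧ P.coeff 0 = 1 := by
  have hev : ∀ z : ℂ, aeval z P = (z - γ) * (z - δ) * ((z - conj γ) * (z - conj δ)) := by
    intro z
    rw [aeval_def, ← eval_map, show algebraMap ℤ ℂ = Int.castRingHom ℂ from rfl, h]
    simp
  have hdeg : P.natDegree = 4 := by
    rw [← hP.natDegree_map (Int.castRingHom ℂ), h]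
    compute_degree!
  have hP0 : P.coeff 0 = 1 := by
    have h1 := hev 0
    rw [← coeff_zero_eq_aeval_zero'] at h1
    have h2 : ((P.coeff 0 : ℤ) : ℂ) = ((‖γ‖ * ‖δ‖ : ℝ) : ℂ) ^ 2 := by
      rw [show ((P.coeff 0 : ℤ) : ℂ) = algebraMap ℤ ℂ (P.coeff 0) from rfl, h1]
      push_cast
      rw [mul_pow, ← Complex.mul_conj', ← Complex.mul_conj']; ring
    rw [hγδ] at h2
    exact_mod_cast (by simpa using h2 : ((P.coeff 0 : ℤ) : ℂ) = 1)
  exact ⟨hev, hdeg, hP0⟩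

open Polynomial ComplexConjugate in
/-- Suppose that a quartic integer polynomial has the roots `γ`, `δ` and their conjugates, where
`‖γ‖ * ‖δ‖ = 1` but `‖γ‖ ≠ 1`. If none of the roots is real, then it is the
minimal polynomial of `γ`. -/
theorem minpoly_eq_of_roots_not_real {P : ℤ[X]} (hP : P.Monic) {γ δ : ℂ}
    (h : P.map (Int.castRingHom ℂ) =
      (X - C γ) * (X - C δ) * ((X - C (conj γ)) * (X - C (conj δ))))
    (hγδ : ‖γ‖ * ‖δ‖ = 1) (hγ1 : ‖γ‖ ≠ 1) (hγ : conj γ ≠ γ) (hδ : conj δ ≠ δ) :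
    minpoly ℤ γ = P := by
  obtain ⟨hev, hdeg, hP0⟩ := eval_and_natDegree_and_coeff_zero_of_roots hP h hγδ
  have hPγ : aeval γ P = 0 := by rw [hev]; simp
  have hint : IsIntegral ℤ γ := ⟨P, hP, hPγ⟩
  obtain ⟨k, hk⟩ := minpoly.isIntegrallyClosed_dvd hint hPγ
  set m := minpoly ℤ γ with hm
  have hmm : m.Monic := minpoly.monic hint
  have hkm : k.Monic := hmm.of_mul_monic_left (hk ▸ hP)
  have hdeg' : m.natDegree + k.natDegree = 4 := by
    rw [← hmm.natDegree_mul hkm, ← hk, hdeg]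
  -- A monic linear factor would give an integer, hence real, root; this excludes degrees 1 and 3.
  have hlin : ∀ q : ℤ[X], q.Monic → q.natDegree = 1 → ¬ q ∣ P := by
    intro q hq hq1 hqP
    have hq0 : aeval ((-q.coeff 0 : ℤ) : ℂ) q = 0 := by
      conv_lhs => rw [hq.eq_X_add_C hq1]
      simp
    have := hev ((-q.coeff 0 : ℤ) : ℂ)
    rw [aeval_eq_zero_of_dvd_aeval_eq_zero hqP hq0] at this
    have hreal : conj ((-q.coeff 0 : ℤ) : ℂ) = ((-q.coeff 0 : ℤ) : ℂ) := by simp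
    rcases mul_eq_zero.1 this.symm with h1 | h1 <;> rcases mul_eq_zero.1 h1 with h2 | h2 <;>
      rw [sub_eq_zero.1 h2] at hreal
    · exact hγ hreal
    · exact hδ hreal
    · exact hγ (by simpa using hreal.symm)
    · exact hδ (by simpa using hreal.symm)
  have hm0 : m.natDegree ≠ 0 := (minpoly.natDegree_pos hint).ne'
  have hm1 : m.natDegree ≠ 1 := fun h1 => hlin m hmm h1 ⟨k, hk⟩
  have hm3 : m.natDegree ≠ 3 := fun h1 => hlin k hkm (by omega) ⟨m, by rw [hk, mul_comm]⟩
  -- A quadratic `m` has roots `γ` and `conj γ`, so `‖γ‖ ^ 2` is its constant term, a divisor of 1.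
  have hm2 : m.natDegree ≠ 2 := by
    intro h2
    have hmγ : aeval γ m = 0 := minpoly.aeval ℤ γ
    have hmγ' : aeval (conj γ) m = 0 := by rw [aeval_conj_int, hmγ, map_zero]
    have hm' : m = X ^ 2 + C (m.coeff 1) * X + C (m.coeff 0) := by
      conv_lhs => rw [hmm.as_sum, h2]
      simp [Finset.sum_range_succ]; ring
    have h3 : γ ^ 2 + m.coeff 1 * γ + m.coeff 0 = 0 := by
      have := hmγ; rw [hm'] at this; simpa using this
    have h4 : conj γ ^ 2 + m.coeff 1 * conj γ + m.coeff 0 = 0 := by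
      have := hmγ'; rw [hm'] at this; simpa using this
    have h5 : conj γ + γ + m.coeff 1 = 0 := by
      refine (mul_eq_zero.1 (?_ : (conj γ - γ) * (conj γ + γ + m.coeff 1) = 0)).resolve_left
        (sub_ne_zero.2 hγ)
      linear_combination h4 - h3
    have h6 : (m.coeff 0 : ℂ) = ((‖γ‖ ^ 2 : ℝ) : ℂ) := by
      push_cast
      rw [← Complex.mul_conj']
      linear_combination h3 - γ * h5
    have h7 : (m.coeff 0 : ℝ) = ‖γ‖ ^ 2 := by exact_mod_cast h6
    have h8 : m.coeff 0 * k.coeff 0 = 1 := by rw [← mul_coeff_zero, ← hk, hP0]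
    rcases Int.eq_one_or_neg_one_of_mul_eq_one h8 with h9 | h9
    · rw [h9] at h7
      refine hγ1 ?_
      have : ‖γ‖ ^ 2 = 1 := by rw [← h7]; simp
      nlinarith [norm_nonneg γ]
    · rw [h9] at h7
      have := sq_nonneg ‖γ‖
      push_cast at h7
      linarith
  have hk0 : k.natDegree = 0 := by omega
  rw [hk, hkm.natDegree_eq_zero.1 hk0, mul_one]

open Polynomial ComplexConjugate in
/-- In the situation of `minpoly_eq_of_roots_not_real`, a real root `γ` forces the
polynomial to be the square of a quadratic polynomial. -/
theorem exists_int_sq_of_root_real {P : ℤ[X]} (hP : P.Monic) {γ δ : ℂ}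
    (h : P.map (Int.castRingHom ℂ) =
      (X - C γ) * (X - C δ) * ((X - C (conj γ)) * (X - C (conj δ))))
    (hγδ : ‖γ‖ * ‖δ‖ = 1) (hγ1 : ‖γ‖ ≠ 1) (hγ : conj γ = γ) :
    ∃ n : ℤ, ‖γ‖ ^ 2 + ‖δ‖ ^ 2 + 2 = (n : ℝ) ^ 2 ∨ ‖γ‖ ^ 2 + ‖δ‖ ^ 2 - 2 = (n : ℝ) ^ 2 := by
  obtain ⟨hev, hdeg, hP0⟩ := eval_and_natDegree_and_coeff_zero_of_roots hP h hγδ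
  have hPγ : aeval γ P = 0 := by rw [hev]; simp
  have hint : IsIntegral ℤ γ := ⟨P, hP, hPγ⟩
  obtain ⟨k, hk⟩ := minpoly.isIntegrallyClosed_dvd hint hPγ
  set m := minpoly ℤ γ with hm
  have hmm : m.Monic := minpoly.monic hint
  have hmγ : aeval γ m = 0 := minpoly.aeval ℤ γ
  have hm0 : 0 < m.natDegree := minpoly.natDegree_pos hint
  have hmd : aeval γ (derivative m) ≠ 0 := by
    intro h0
    have h1 : derivative m ≠ 0 := by
      intro h1
      have := derivative_eq_zero.1 h1
      omega
    have h2 := natDegree_le_of_dvd (minpoly.isIntegrallyClosed_dvd hint h0) h1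
    have h3 := natDegree_derivative_lt hm0.ne'
    rw [← hm] at h2
    omega
  -- A real `γ` equals its conjugate and is a double root of `P`, while it is a simple root of `m`;
  -- hence `m ^ 2` divides `P`.
  have hPd : aeval γ (derivative P) = 0 := by
    rw [aeval_def, ← eval_map, ← derivative_map, show algebraMap ℤ ℂ = Int.castRingHom ℂ from rfl,
      h, hγ]
    simp [derivative_mul]
  have hkγ : aeval γ k = 0 := by
    rw [hk, derivative_mul, map_add, map_mul, map_mul, hmγ, zero_mul, add_zero] at hPd
    exact (mul_eq_zero.1 hPd).resolve_left hmd
  obtain ⟨r, hr⟩ := minpoly.isIntegrallyClosed_dvd hint hkγ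
  rw [← hm] at hr
  have hkm : k.Monic := hmm.of_mul_monic_left (hk ▸ hP)
  have hrm : r.Monic := hmm.of_mul_monic_left (hr ▸ hkm)
  have hdeg' : m.natDegree + (m.natDegree + r.natDegree) = 4 := by
    rw [← hmm.natDegree_mul hrm, ← hr, ← hmm.natDegree_mul hkm, ← hk, hdeg]
  have hm00 : m.coeff 0 = 1 ∨ m.coeff 0 = -1 := by
    refine Int.eq_one_or_neg_one_of_mul_eq_one (v := k.coeff 0) ?_
    rw [← mul_coeff_zero, ← hk, hP0]
  have hm1 : m.natDegree ≠ 1 := by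
    intro h1
    have h2 : γ + m.coeff 0 = 0 := by
      have := hmγ; rw [hmm.eq_X_add_C h1] at this; simpa using this
    refine hγ1 ?_
    rw [eq_neg_of_add_eq_zero_left h2]
    rcases hm00 with h3 | h3 <;> rw [h3] <;> simp
  have hm2 : m.natDegree = 2 := by omega
  have hr1 : r = 1 := hrm.natDegree_eq_zero.1 (by omega)
  have hmδ : aeval δ m = 0 := by
    have h1 : aeval δ P = 0 := by rw [hev]; simp
    rw [hk, hr, hr1, mul_one, map_mul] at h1
    exact mul_self_eq_zero.1 h1
  have hm' : m = X ^ 2 + C (m.coeff 1) * X + C (m.coeff 0) := by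
    conv_lhs => rw [hmm.as_sum, hm2]
    simp [Finset.sum_range_succ]; ring
  have h3 : γ ^ 2 + m.coeff 1 * γ + m.coeff 0 = 0 := by
    have := hmγ; rw [hm'] at this; simpa using this
  have h4 : δ ^ 2 + m.coeff 1 * δ + m.coeff 0 = 0 := by
    have := hmδ; rw [hm'] at this; simpa using this
  have hne : δ - γ ≠ 0 := by
    intro h0
    rw [sub_eq_zero.1 h0] at hγδ
    exact hγ1 (by nlinarith [norm_nonneg γ])
  have h5 : δ + γ + m.coeff 1 = 0 := by
    refine (mul_eq_zero.1 (?_ : (δ - γ) * (δ + γ + m.coeff 1) = 0)).resolve_left hne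
    linear_combination h4 - h3
  have hδ : conj δ = δ := by
    have h6 : δ = -γ - m.coeff 1 := by linear_combination h5
    rw [h6]; simp [hγ]
  have hsq : ∀ z : ℂ, conj z = z → ((‖z‖ ^ 2 : ℝ) : ℂ) = z ^ 2 := by
    intro z hz
    push_cast
    rw [← Complex.mul_conj', hz, sq]
  -- Both roots of `m` are real, so this is `γ² + δ² = (γ + δ)² - 2γδ`.
  have h7 : ((‖γ‖ ^ 2 + ‖δ‖ ^ 2 : ℝ) : ℂ) = m.coeff 1 ^ 2 - 2 * m.coeff 0 := by
    rw [Complex.ofReal_add, hsq γ hγ, hsq δ hδ]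
    linear_combination h3 + h4 - m.coeff 1 * h5
  have h8 : ‖γ‖ ^ 2 + ‖δ‖ ^ 2 = (m.coeff 1 : ℝ) ^ 2 - 2 * m.coeff 0 := by exact_mod_cast h7
  refine ⟨m.coeff 1, hm00.imp (fun h9 => ?_) fun h9 => ?_⟩ <;> rw [h8, h9] <;> push_cast <;> ring

/-! ### Eigenvalues of an automorphism of positive entropy -/

namespace ComplexTwoTorus

open Polynomial ComplexConjugate

theorem exists_charpoly_eq (A : (Fin 2 → ℂ) →L[ℂ] (Fin 2 → ℂ)) :
    ∃ α β : ℂ, ‖β‖ ≤ ‖α‖ ∧ A.toLinearMap.charpoly = (X - C α) * (X - C β) := by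
  set p := A.toLinearMap.charpoly with hp
  have hs := (IsAlgClosed.splits p).eq_prod_roots
  have hm : p.Monic := LinearMap.charpoly_monic _
  have hc : p.roots.card = 2 := by
    rw [← (IsAlgClosed.splits p).natDegree_eq_card_roots, hp, LinearMap.charpoly_natDegree]
    simp
  obtain ⟨α, β, hαβ⟩ := Multiset.card_eq_two.1 hc
  rw [hαβ, hm.leadingCoeff] at hs
  rcases le_total ‖β‖ ‖α‖ with h | h
  · exact ⟨α, β, h, by simpa using hs⟩
  · exact ⟨β, α, h, by rw [mul_comm]; simpa using hs⟩

/-- By Cayley–Hamilton, `A B = α B` for `B = A - β`, whence `A ^ (k + 1) = β A ^ k + α ^ k B` and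
the norms grow at most linearly, even for a Jordan block. Bernoulli's inequality absorbs the linear
factor. -/
theorem exists_norm_pow_le {A : (Fin 2 → ℂ) →L[ℂ] (Fin 2 → ℂ)} {α β : ℂ}
    (hA : A.toLinearMap.charpoly = (X - C α) * (X - C β)) (hα : ‖α‖ = 1) (hβ : ‖β‖ = 1)
    {r : ℝ} (hr : 1 < r) : ∃ D > 0, ∀ k, ‖A ^ k‖ ≤ D * r ^ k := by
  set B : (Fin 2 → ℂ) →L[ℂ] (Fin 2 → ℂ) := A - β • 1 with hB
  have hCH : A * B = α • B := by
    have h1 := LinearMap.aeval_self_charpoly A.toLinearMap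
    rw [hA] at h1
    ext1 v
    have h2 := LinearMap.congr_fun h1 v
    simp only [map_mul, map_sub, aeval_X, aeval_C, LinearMap.zero_apply] at h2
    have h3 : A (B v) - α • B v = 0 := h2
    exact sub_eq_zero.1 h3
  have hAB : ∀ k, A ^ k * B = α ^ k • B := by
    intro k
    induction k with
    | zero => simp
    | succ k ih =>
      rw [pow_succ, mul_assoc, hCH, pow_succ', ← smul_smul, ← ih]
      ext1 v
      simp
  have hb : ∀ k : ℕ, ‖A ^ k‖ ≤ ‖(1 : (Fin 2 → ℂ) →L[ℂ] (Fin 2 → ℂ))‖ + k * ‖B‖ := by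
    intro k
    induction k with
    | zero => simp
    | succ k ih =>
      have h1 : A ^ (k + 1) = β • A ^ k + α ^ k • B := by
        rw [← hAB, hB, mul_sub, pow_succ]
        ext1 v
        simp
      rw [h1]
      refine (norm_add_le _ _).trans ?_
      rw [norm_smul, norm_smul, norm_pow α, hα, hβ, one_pow, one_mul, one_mul]
      push_cast
      linarith
  set e := ‖(1 : (Fin 2 → ℂ) →L[ℂ] (Fin 2 → ℂ))‖
  have hr0 : 0 < r - 1 := by linarith
  refine ⟨e + 1 + ‖B‖ / (r - 1), by positivity, fun k => (hb k).trans ?_⟩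
  have h1 : 1 + (k : ℝ) * (r - 1) ≤ r ^ k := by
    have := one_add_mul_le_pow (a := r - 1) (by linarith) k
    rwa [add_sub_cancel] at this
  have h2 : 1 ≤ r ^ k := one_le_pow₀ hr.le
  have h3 : k * ‖B‖ = ‖B‖ / (r - 1) * (k * (r - 1)) := by field_simp
  have h4 : k * (r - 1) ≤ r ^ k := by linarith
  calc e + k * ‖B‖ ≤ (e + 1) * 1 + ‖B‖ / (r - 1) * (k * (r - 1)) := by rw [h3]; linarith
    _ ≤ (e + 1) * r ^ k + ‖B‖ / (r - 1) * r ^ k := by gcongr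
    _ = _ := by ring

/-- A linear map with distinct eigenvalues is diagonal in suitable coordinates. -/
theorem exists_diagonal {A : (Fin 2 → ℂ) →L[ℂ] (Fin 2 → ℂ)} {α β : ℂ}
    (hA : A.toLinearMap.charpoly = (X - C α) * (X - C β)) (hαβ : α ≠ β) :
    ∃ L : (Fin 2 → ℂ) ≃L[ℂ] (Fin 2 → ℂ), (∀ v i, L (A v) i = ![α, β] i * L v i) := by
  have hev : ∀ i, Module.End.HasEigenvalue A.toLinearMap (![α, β] i) := by
    intro i
    rw [Module.End.hasEigenvalue_iff_isRoot_charpoly, hA]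
    fin_cases i <;> simp
  choose u hu using fun i => (hev i).exists_hasEigenvector
  have hinj : Function.Injective ![α, β] := by
    intro i j hij
    fin_cases i <;> fin_cases j <;> simp_all
  have hli := Module.End.eigenvectors_linearIndependent' A.toLinearMap ![α, β] hinj u hu
  let b := basisOfLinearIndependentOfCardEqFinrank hli (by simp)
  have hb : ∀ i, b i = u i := fun i => by simp [b]
  refine ⟨b.equivFun.toContinuousLinearEquiv, fun v i => ?_⟩
  change b.equivFun (A v) i = _ * b.equivFun v i
  conv_lhs => rw [← b.sum_equivFun v]
  have hAu : ∀ j, A (u j) = ![α, β] j • u j := fun j => (hu j).apply_eq_smul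
  simp only [map_sum, map_smul, hb, hAu]
  simp only [← hb, Finset.sum_apply, Pi.smul_apply, Module.Basis.equivFun_self, smul_eq_mul]
  fin_cases i <;> simp [mul_comm]

/-- If `X` has an automorphism of positive entropy `log lam`, then the linear part of the
automorphism is diagonalizable, with eigenvalues of absolute value `lam ^ (1 / 2)` and
`lam ^ (-1 / 2)`, and its characteristic polynomial on the lattice is the integral polynomial whose
roots are these eigenvalues and their conjugates. -/
theorem AdmitsAutomorphismOfEntropy.exists_eigenvalues {X : ComplexTwoTorus} {lam : ℝ}
    (hlam : 1 < lam) (h : X.AdmitsAutomorphismOfEntropy (Real.log lam)) :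
    ∃ (A : (Fin 2 → ℂ) →L[ℂ] (Fin 2 → ℂ)) (L : (Fin 2 → ℂ) ≃L[ℂ] (Fin 2 → ℂ)) (α β : ℂ)
      (P : ℤ[X]), (∀ v ∈ X.lattice, A v ∈ X.lattice) ∧ (∀ v i, L (A v) i = ![α, β] i * L v i) ∧
      P.Monic ∧ P.map (Int.castRingHom ℂ) =
        (Polynomial.X - C α) * (Polynomial.X - C β) *
          ((Polynomial.X - C (conj α)) * (Polynomial.X - C (conj β))) ∧
      ‖α‖ * ‖β‖ = 1 ∧ ‖α‖ ^ 2 = lam := by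
  obtain ⟨f, hf, hfe⟩ := h
  obtain ⟨A, B, hBA, hA, hB, c, hfA⟩ := hf.exists_affine
  obtain ⟨α, β, hαβ, hch⟩ := exists_charpoly_eq A
  obtain ⟨P, hPm, hPd, hP⟩ := X.exists_int_charpoly hA
  obtain ⟨Q, hQm, hQd, hQ⟩ := X.exists_int_charpoly hB
  have hPmap : P.map (Int.castRingHom ℂ) =
        (Polynomial.X - C α) * (Polynomial.X - C β) *
          ((Polynomial.X - C (conj α)) * (Polynomial.X - C (conj β))) := by
    refine Polynomial.eq_of_forall_eval_ofReal_eq fun t => ?_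
    have h1 : (P.map (Int.castRingHom ℂ)).eval (t : ℂ) = ((aeval t P : ℝ) : ℂ) := by
      rw [eval_map]
      exact aeval_algebraMap_apply ℂ t P
    rw [h1, hP, hch, ← Complex.mul_conj]
    simp
  have hdet : ∀ (T : (Fin 2 → ℂ) →L[ℂ] (Fin 2 → ℂ)) (R : ℤ[X]),
      (∀ t : ℝ, aeval t R = Complex.normSq (T.toLinearMap.charpoly.eval (t : ℂ))) →
      (R.coeff 0 : ℝ) = Complex.normSq (-T.toLinearMap).det := by
    intro T R hR
    have h1 := hR 0
    rw [← coeff_zero_eq_aeval_zero', LinearMap.eval_charpoly] at h1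
    simpa using h1
  have hPQ : P.coeff 0 * Q.coeff 0 = 1 := by
    have h1 : ((P.coeff 0 * Q.coeff 0 : ℤ) : ℝ) = 1 := by
      push_cast
      rw [hdet A P hP, hdet B Q hQ, ← map_mul, mul_comm, ← map_mul]
      have : (-B.toLinearMap) * (-A.toLinearMap) = 1 := by
        refine LinearMap.ext fun v => ?_
        rw [Module.End.mul_apply, LinearMap.neg_apply, LinearMap.neg_apply, map_neg, neg_neg]
        exact congrArg (fun T : (Fin 2 → ℂ) →L[ℂ] (Fin 2 → ℂ) => T v) hBA
      rw [this]; simp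
    exact_mod_cast h1
  -- The integer `P.coeff 0` is a unit, and nonnegative because it is the squared modulus of a
  -- complex determinant.
  have hP0 : P.coeff 0 = 1 := by
    refine (Int.eq_one_or_neg_one_of_mul_eq_one hPQ).resolve_right fun h1 => ?_
    have h2 := hdet A P hP
    rw [h1] at h2
    have := Complex.normSq_nonneg (-A.toLinearMap).det
    push_cast at h2
    linarith
  have hnorm : ‖α‖ * ‖β‖ = 1 := by
    have h1 := hP 0
    rw [← coeff_zero_eq_aeval_zero', hP0, hch, Complex.normSq_eq_norm_sq] at h1
    have h2 : (‖α‖ * ‖β‖) ^ 2 = 1 := by simpa using h1.symm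
    nlinarith [mul_nonneg (norm_nonneg α) (norm_nonneg β)]
  have hα1 : 1 ≤ ‖α‖ := by nlinarith [norm_nonneg α, norm_nonneg β]
  have hβ1 : ‖β‖ ≤ 1 := by nlinarith [norm_nonneg α, norm_nonneg β]
  rcases hα1.eq_or_lt with hα | hα
  · exfalso
    have hβ : ‖β‖ = 1 := by rwa [← hα, one_mul] at hnorm
    -- With this `r` the crude bound `4 log r` is only half of `log lam`, contradicting the entropy.
    set r : ℝ := Real.exp (Real.log lam / 8) with hr
    have hlog : 0 < Real.log lam := Real.log_pos hlam
    have hr1 : 1 < r := Real.one_lt_exp_iff.2 (by positivity)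
    obtain ⟨D, hD, hDk⟩ := exists_norm_pow_le hch hα.symm hβ hr1
    have h1 := entropy_le_of_norm_pow_le hfA hD hr1.le hDk
    rw [hfe, EReal.coe_le_coe_iff, Real.log_pow, hr, Real.log_exp] at h1
    push_cast at h1
    linarith
  · have hne : α ≠ β := by
      rintro rfl
      nlinarith
    obtain ⟨L, hL⟩ := exists_diagonal hch hne
    refine ⟨A, L, α, β, P, hA, hL, hPm, hPmap, hnorm, ?_⟩
    have h1 := entropy_le_of_diagonal hfA L hL (by simpa using hα1) (by simpa using hβ1)
    have h2 : (Real.log (‖α‖ ^ 2) : EReal) ≤ entropy f := by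
      refine log_le_entropy_of_eigenvector hfA hα (u := L.symm (Pi.single 0 1)) ?_ ?_
      · apply L.injective
        ext i
        rw [hL, map_smul, L.apply_symm_apply]
        fin_cases i <;> simp
      · simp
    rw [hfe, EReal.coe_le_coe_iff] at h1 h2
    have h3 : Real.log (‖α‖ ^ 2) = Real.log lam := le_antisymm h2 (by simpa using h1)
    exact Real.log_injOn_pos (Set.mem_Ioi.2 (by positivity)) (Set.mem_Ioi.2 (by linarith)) h3

end ComplexTwoTorus

/-! ### Lattices stable under a diagonal matrix -/

open MeasureTheory Module in
/-- Every lattice contains a nonzero vector that is short in terms of the covolume. -/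
theorem exists_forall_lattice_exists_norm_pow_le {E ι : Type*} [NormedAddCommGroup E]
    [NormedSpace ℝ E] [FiniteDimensional ℝ E] [Nontrivial E] [Fintype ι] [DecidableEq ι]
    (b₀ : Basis ι ℝ E) :
    ∃ D : ℝ, ∀ (Λ : Submodule ℤ E) [DiscreteTopology Λ] [IsZLattice ℝ Λ] (b : Basis ι ℤ Λ),
      ∃ v ∈ Λ, v ≠ 0 ∧ ‖v‖ ^ finrank ℝ E ≤ D * |b₀.det (b.ofZLatticeBasis ℝ Λ)| := by
  let _ : MeasurableSpace E := borel E
  have : BorelSpace E := ⟨rfl⟩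
  set ν : Measure E := b₀.addHaar
  set κ := ν.real (Metric.ball 0 1)
  have hκ : 0 < κ := ENNReal.toReal_pos (Metric.measure_ball_pos ν 0 one_pos).ne'
    measure_ball_lt_top.ne
  set V := ν.real (ZSpan.fundamentalDomain b₀)
  have hd : finrank ℝ E ≠ 0 := finrank_pos.ne'
  -- Minkowski needs a ball of volume more than `2 ^ d` times the covolume `|det| * V`; the `+ 1`
  -- makes this strict.
  refine ⟨(2 ^ finrank ℝ E + 1) * V / κ, fun Λ _ _ b => ?_⟩
  set bR := b.ofZLatticeBasis ℝ Λ
  have hV : 0 < V := by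
    refine ENNReal.toReal_pos (ZSpan.measure_fundamentalDomain_ne_zero b₀)
      (ZSpan.fundamentalDomain_isBounded b₀).measure_lt_top.ne
  have hdet : 0 < |b₀.det bR| := abs_pos.2 (b₀.isUnit_det bR).ne_zero
  set y : ℝ := (2 ^ finrank ℝ E + 1) * V / κ * |b₀.det bR| with hy
  have hy0 : 0 < y := by positivity
  set ρ : ℝ := y ^ ((finrank ℝ E : ℝ)⁻¹) with hρ
  have hρ0 : 0 < ρ := by positivity
  have hρy : ρ ^ finrank ℝ E = y := Real.rpow_inv_natCast_pow hy0.le hd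
  have hfund : IsAddFundamentalDomain Λ.toAddSubgroup (ZSpan.fundamentalDomain bR) ν :=
    ZLattice.isAddFundamentalDomain b ν
  have hcount : Countable Λ.toAddSubgroup := inferInstanceAs (Countable Λ)
  obtain ⟨v, hv0, hv⟩ := exists_ne_zero_mem_lattice_of_measure_mul_two_pow_lt_measure
    (s := Metric.ball (0 : E) ρ) hfund (fun x hx => by simpa using hx) (convex_ball 0 ρ) (by
      have hfin : ν (ZSpan.fundamentalDomain bR) ≠ ⊤ :=
        (ZSpan.fundamentalDomain_isBounded bR).measure_lt_top.ne
      rw [← ENNReal.toReal_lt_toReal (by finiteness) measure_ball_lt_top.ne, ENNReal.toReal_mul,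
        Measure.addHaar_ball ν 0 hρ0.le, hρy, ENNReal.toReal_mul, ENNReal.toReal_ofReal hy0.le]
      change ν.real (ZSpan.fundamentalDomain bR) * _ < y * κ
      rw [ZSpan.measureReal_fundamentalDomain bR ν b₀]
      have h1 : y * κ = |b₀.det bR| * V * 2 ^ finrank ℝ E + |b₀.det bR| * V := by
        rw [hy]; field_simp
      rw [h1]
      simp only [ENNReal.toReal_pow, ENNReal.toReal_ofNat]
      have : 0 < |b₀.det bR| * V := by positivity
      linarith)
  refine ⟨v, v.2, fun h => hv0 (Subtype.ext h), ?_⟩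
  rw [← hρy]
  have : ‖(v : E)‖ < ρ := by simpa using hv
  gcongr

/-- Let `Λ` be a lattice that is stable under a diagonal matrix whose eigenvalues are algebraic
numbers of degree at least four. After rescaling the coordinates, `Λ` contains the lattice generated
by the powers of the eigenvalues with bounded index. -/
theorem exists_nat_forall_lattice_smul_mem {μ : Fin 2 → ℂ}
    (hμ : ∀ i, ∀ c : Fin 4 → ℤ, ∑ k, c k * μ i ^ (k : ℕ) = 0 → c = 0) :
    ∃ M : ℕ, M ≠ 0 ∧ ∀ (Λ : Submodule ℤ (Fin 2 → ℂ)) [DiscreteTopology Λ] [IsZLattice ℝ Λ],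
      (∀ v ∈ Λ, μ * v ∈ Λ) → ∃ t : Fin 2 → ℂ, (∀ i, t i ≠ 0) ∧
        (∀ k : Fin 4, t * μ ^ (k : ℕ) ∈ Λ) ∧
        ∀ v ∈ Λ, ∃ c : Fin 4 → ℤ, (M : ℤ) • v = ∑ k, c k • (t * μ ^ (k : ℕ)) := by
  have hfin : Module.finrank ℝ (Fin 2 → ℂ) = 4 := by
    simp [Module.finrank_pi_fintype, Complex.finrank_real_complex]
  let b₀ : Module.Basis (Fin 4) ℝ (Fin 2 → ℂ) := Module.finBasisOfFinrankEq ℝ _ hfin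
  obtain ⟨D, hD⟩ := exists_forall_lattice_exists_norm_pow_le b₀
  set w : Fin 4 → Fin 2 → ℂ := fun k => μ ^ (k : ℕ) with hw
  -- The index of the span of the `t * μ ^ k` in `Λ` is at most the ceiling, so it divides the
  -- factorial, whatever `Λ` is.
  refine ⟨(⌈D * |b₀.det w|⌉₊).factorial, Nat.factorial_ne_zero _, fun Λ _ _ hΛ => ?_⟩
  have := ZLattice.module_free ℝ Λ
  have := ZLattice.module_finite ℝ Λ
  let b : Module.Basis (Fin 4) ℤ Λ := Module.finBasisOfFinrankEq ℤ Λ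
    ((ZLattice.rank ℝ Λ).trans hfin)
  set bR := b.ofZLatticeBasis ℝ Λ with hbR
  obtain ⟨t, htΛ, ht0, ht⟩ := hD Λ b
  rw [hfin] at ht
  have huΛ : ∀ k : ℕ, t * μ ^ k ∈ Λ := by
    intro k
    induction k with
    | zero => simpa
    | succ k ih => rw [pow_succ', mul_left_comm]; exact hΛ _ ih
  let u : Fin 4 → Λ := fun k => ⟨t * μ ^ (k : ℕ), huΛ k⟩
  have hsum : ∀ c : Fin 4 → ℤ, (((∑ k, c k • u k : Λ)) : Fin 2 → ℂ)
      = ∑ k, c k • (t * μ ^ (k : ℕ)) := fun c => by simp [u]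
  set B := b.toMatrix u with hB
  have hBc : ∀ c : Fin 4 → ℤ, ∀ i, b.repr (∑ k, c k • u k) i = (B.mulVec c) i := by
    intro c i
    simp [Matrix.mulVec, dotProduct, hB, Module.Basis.toMatrix_apply, mul_comm]
  have hdet0 : B.det ≠ 0 := by
    intro h0
    obtain ⟨c, hc0, hc⟩ := Matrix.exists_mulVec_eq_zero_iff.2 h0
    have h1 : (∑ k, c k • u k : Λ) = 0 := by
      refine b.repr.injective ?_
      ext i
      rw [hBc, hc]; simp
    have h2 : ∑ k, c k • (t * μ ^ (k : ℕ)) = 0 := by rw [← hsum, h1]; rfl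
    obtain ⟨i, hi⟩ := Function.ne_iff.1 ht0
    refine hc0 (hμ i c ?_)
    refine (mul_eq_zero.1 (?_ : t i * ∑ k, c k * μ i ^ (k : ℕ) = 0)).resolve_left hi
    have h3 := congrFun h2 i
    simp only [Finset.sum_apply, Pi.smul_apply, Pi.mul_apply, Pi.pow_apply, Pi.zero_apply] at h3
    simp only [zsmul_eq_mul] at h3
    rw [← h3, Finset.mul_sum]
    exact Finset.sum_congr rfl fun k _ => by ring
  have hdetR : b₀.det (fun k => (u k : Fin 2 → ℂ)) = b₀.det bR * (B.det : ℝ) := by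
    rw [Module.Basis.det_apply, Module.Basis.det_apply,
      ← Module.Basis.toMatrix_mul_toMatrix b₀ bR, Matrix.det_mul]
    congr 1
    rw [← eq_intCast (Int.castRingHom ℝ), RingHom.map_det]
    congr 1
    ext i k
    rw [Module.Basis.toMatrix_apply, hbR, Module.Basis.ofZLatticeBasis_repr_apply]
    rfl
  have hdett : b₀.det (fun k => (u k : Fin 2 → ℂ)) = Complex.normSq (t 0 * t 1) * b₀.det w := by
    have h1 : (fun k => (u k : Fin 2 → ℂ)) =
        ((Matrix.toLin' (Matrix.diagonal t)).restrictScalars ℝ) ∘ w := by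
      funext k
      ext i
      simp [u, hw, Matrix.mulVec_diagonal]
    rw [h1, Module.Basis.det_comp, LinearMap.det_restrictScalars, LinearMap.det_toLin',
      Matrix.det_diagonal, Algebra.norm_complex_apply, Fin.prod_univ_two]
  have hbRdet : 0 < |b₀.det bR| := abs_pos.2 (b₀.isUnit_det bR).ne_zero
  have ht01 : t 0 * t 1 ≠ 0 := by
    intro h0
    rw [hdett, h0, map_zero, zero_mul] at hdetR
    refine hdet0 ?_
    exact_mod_cast (mul_eq_zero.1 hdetR.symm).resolve_left (abs_pos.1 hbRdet)
  -- The covolume of the span is `‖t 0 * t 1‖ ^ 2 * |det w|` up to a constant. By the choice of `t`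
  -- the first factor is at most `D` times that of `Λ`, so the covolume of `Λ` cancels from the
  -- index.
  have hbound : |(B.det : ℝ)| ≤ D * |b₀.det w| := by
    have h1 : Complex.normSq (t 0 * t 1) ≤ ‖t‖ ^ 4 := by
      rw [Complex.normSq_eq_norm_sq, norm_mul]
      calc (‖t 0‖ * ‖t 1‖) ^ 2 ≤ (‖t‖ * ‖t‖) ^ 2 := by
            gcongr <;> exact norm_le_pi_norm t _
        _ = ‖t‖ ^ 4 := by ring
    have h2 : |b₀.det bR| * |(B.det : ℝ)| = Complex.normSq (t 0 * t 1) * |b₀.det w| := by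
      rw [← abs_mul, ← hdetR, hdett, abs_mul, abs_of_nonneg (Complex.normSq_nonneg _)]
    refine le_of_mul_le_mul_left ?_ hbRdet
    calc |b₀.det bR| * |(B.det : ℝ)| ≤ (D * |b₀.det bR|) * |b₀.det w| := by
          rw [h2]
          gcongr
          exact h1.trans ht
      _ = _ := by ring
  have hdvd : B.det ∣ ((⌈D * |b₀.det w|⌉₊).factorial : ℤ) := by
    rw [← Int.natAbs_dvd_natAbs, Int.natAbs_natCast]
    refine Nat.dvd_factorial (Int.natAbs_pos.2 hdet0) ?_
    have h1 : ((B.det.natAbs : ℕ) : ℝ) = |(B.det : ℝ)| := by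
      rw [Nat.cast_natAbs, Int.cast_abs]
    exact_mod_cast (h1 ▸ hbound).trans (Nat.le_ceil _)
  obtain ⟨q, hq⟩ := hdvd
  refine ⟨t, fun i => ?_, fun k => huΛ k, fun v hv => ?_⟩
  · fin_cases i
    · exact left_ne_zero_of_mul ht01
    · exact right_ne_zero_of_mul ht01
  -- Cramer's rule: `B * B.adjugate = B.det`, and `q` is the cofactor of `B.det` in `M`.
  · refine ⟨q • B.adjugate.mulVec (b.repr ⟨v, hv⟩), ?_⟩
    rw [hq, ← hsum]
    refine congrArg Subtype.val (?_ : (B.det * q) • (⟨v, hv⟩ : Λ) = _)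
    refine b.repr.injective ?_
    ext i
    rw [hBc, Matrix.mulVec_smul, Matrix.mulVec_mulVec, Matrix.mul_adjugate, Matrix.smul_mulVec,
      Matrix.one_mulVec]
    simp only [map_smul, Finsupp.smul_apply, Pi.smul_apply, smul_eq_mul]
    ring

/-- A lattice as in `exists_nat_forall_lattice_smul_mem` is determined, up to the choice of linear
coordinates, by one of finitely many sets of residue classes. -/
theorem exists_nat_forall_lattice_mem_iff {μ : Fin 2 → ℂ}
    (hμ : ∀ i, ∀ c : Fin 4 → ℤ, ∑ k, c k * μ i ^ (k : ℕ) = 0 → c = 0) :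
    ∃ M : ℕ, M ≠ 0 ∧ ∀ (Λ : Submodule ℤ (Fin 2 → ℂ)) [DiscreteTopology Λ] [IsZLattice ℝ Λ],
      (∀ v ∈ Λ, μ * v ∈ Λ) → ∃ (T : (Fin 2 → ℂ) ≃L[ℂ] (Fin 2 → ℂ)) (S : Set (Fin 4 → ZMod M)),
        ∀ v, v ∈ Λ ↔ ∃ c : Fin 4 → ℤ, (fun k => (c k : ZMod M)) ∈ S ∧
          (M : ℤ) • T v = ∑ k, c k • μ ^ (k : ℕ) := by
  obtain ⟨M, hM, h⟩ := exists_nat_forall_lattice_smul_mem hμ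
  refine ⟨M, hM, fun Λ _ _ hΛ => ?_⟩
  obtain ⟨t, ht0, htΛ, htM⟩ := h Λ hΛ
  let T : (Fin 2 → ℂ) ≃L[ℂ] (Fin 2 → ℂ) := (LinearEquiv.piCongrRight fun i =>
    LinearEquiv.smulOfNeZero ℂ ℂ (t i)⁻¹ (inv_ne_zero (ht0 i))).toContinuousLinearEquiv
  have hT : ∀ v, t * T v = v := by
    intro v
    ext i
    change t i * ((t i)⁻¹ * v i) = v i
    rw [mul_inv_cancel_left₀ (ht0 i)]
  have hiff : ∀ v (c : Fin 4 → ℤ), (M : ℤ) • T v = ∑ k, c k • μ ^ (k : ℕ) ↔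
      (M : ℤ) • v = ∑ k, c k • (t * μ ^ (k : ℕ)) := by
    intro v c
    have h1 : ∑ k, c k • (t * μ ^ (k : ℕ)) = t * ∑ k, c k • μ ^ (k : ℕ) := by
      rw [Finset.mul_sum]; exact Finset.sum_congr rfl fun k _ => (mul_smul_comm _ _ _).symm
    have h2 : (M : ℤ) • v = t * (M : ℤ) • T v := by rw [mul_smul_comm, hT]
    rw [h1, h2]
    refine ⟨fun h => by rw [h], fun h => ?_⟩
    ext i
    exact mul_left_cancel₀ (ht0 i) (congrFun h i)
  -- `S` records the coefficient vectors of `M • Λ` modulo `M`. Residues suffice, since changing `c`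
  -- by a multiple of `M` moves `v` by a combination of the `t * μ ^ k`, which lie in `Λ`.
  refine ⟨T, {x | ∃ c : Fin 4 → ℤ, (fun k => (c k : ZMod M)) = x ∧ ∃ v ∈ Λ,
    (M : ℤ) • v = ∑ k, c k • (t * μ ^ (k : ℕ))}, fun v => ⟨fun hv => ?_, ?_⟩⟩
  · obtain ⟨c, hc⟩ := htM v hv
    exact ⟨c, ⟨c, rfl, v, hv, hc⟩, (hiff v c).2 hc⟩
  · rintro ⟨c, ⟨c', hcc', v', hv', hc'⟩, hc⟩
    rw [hiff] at hc
    have hd : ∀ k, ∃ d : ℤ, c k - c' k = M * d := by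
      intro k
      have := congrFun hcc' k
      exact (ZMod.intCast_eq_intCast_iff_dvd_sub _ _ _).1 this
    choose d hd using hd
    have hv : v = v' + ∑ k, d k • (t * μ ^ (k : ℕ)) := by
      have hM' : (M : ℤ) ≠ 0 := by exact_mod_cast hM
      refine smul_right_injective _ hM' ?_
      simp only
      rw [smul_add, hc, hc', Finset.smul_sum, ← Finset.sum_add_distrib]
      refine Finset.sum_congr rfl fun k _ => ?_
      rw [smul_smul, ← hd, ← add_smul]
      congr 1; ring
    rw [hv]
    exact Λ.add_mem hv' (Λ.sum_mem fun k _ => Λ.smul_mem _ (htΛ k))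

open Polynomial in
theorem eq_zero_of_sum_mul_pow_eq_zero {z : ℂ} {n : ℕ} (hz : IsIntegral ℤ z)
    (hn : n ≤ (minpoly ℤ z).natDegree) {c : Fin n → ℤ} (h : ∑ k, c k * z ^ (k : ℕ) = 0) :
    c = 0 := by
  set Q : ℤ[X] := ∑ k : Fin n, C (c k) * X ^ (k : ℕ) with hQ
  have hQz : aeval z Q = 0 := by rw [← h, hQ]; simp
  have hdeg : Q.degree < (minpoly ℤ z).degree := by
    refine (degree_sum_fin_lt c).trans_le ?_
    rw [degree_eq_natDegree (minpoly.monic hz).ne_zero]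
    exact_mod_cast hn
  have hQ0 : Q = 0 := by
    by_contra hne
    exact (degree_le_of_dvd (minpoly.isIntegrallyClosed_dvd hz hQz) hne).not_gt hdeg
  funext k
  have : Q.coeff k = c k := by
    simp [hQ, coeff_X_pow, Fin.val_inj]
  rw [← this, hQ0]; simp

/-! ### Finiteness of the isomorphism classes -/

namespace ComplexTwoTorus

open Polynomial ComplexConjugate

/-- All tori with the same residue set `S` have the same lattice after a linear change of
coordinates, so each of the finitely many `S` accounts for at most one class. -/
theorem finite_isoClass_of_eigenvalues {μ : Fin 2 → ℂ}
    (hμ : ∀ i, ∀ c : Fin 4 → ℤ, ∑ k, c k * μ i ^ (k : ℕ) = 0 → c = 0) :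
    (isoClass '' {X : ComplexTwoTorus | ∃ (A : (Fin 2 → ℂ) →L[ℂ] (Fin 2 → ℂ))
      (L : (Fin 2 → ℂ) ≃L[ℂ] (Fin 2 → ℂ)), (∀ v ∈ X.lattice, A v ∈ X.lattice) ∧
        ∀ v i, L (A v) i = μ i * L v i}).Finite := by
  obtain ⟨M, hM, h⟩ := exists_nat_forall_lattice_mem_iff hμ
  have : NeZero M := ⟨hM⟩
  let R : Set (Fin 4 → ZMod M) → Set ComplexTwoTorus := fun S =>
    {X | ∃ T : (Fin 2 → ℂ) ≃L[ℂ] (Fin 2 → ℂ), ∀ v, v ∈ X.lattice ↔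
      ∃ c : Fin 4 → ℤ, (fun k => (c k : ZMod M)) ∈ S ∧ (M : ℤ) • T v = ∑ k, c k • μ ^ (k : ℕ)}
  have hR : ∀ S, (isoClass '' R S).Finite := by
    intro S
    refine Set.Subsingleton.finite ?_
    rintro _ ⟨X, ⟨T, hT⟩, rfl⟩ _ ⟨Y, ⟨T', hT'⟩, rfl⟩
    refine isoClass_eq_of_linearEquiv (T.trans T'.symm) fun v => ?_
    rw [hT, hT']
    simp
  refine (Set.finite_iUnion hR).subset ?_
  rw [← Set.image_iUnion]
  refine Set.image_mono fun X => ?_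
  rintro ⟨A, L, hA, hL⟩
  -- The lattice is transported by `L`, so that `A` becomes multiplication by `μ`.
  let e : (Fin 2 → ℂ) ≃L[ℝ] (Fin 2 → ℂ) := L.symm.restrictScalars ℝ
  have hmem : ∀ v, v ∈ ZLattice.comap ℝ X.lattice e.toLinearMap ↔ L.symm v ∈ X.lattice :=
    fun v => Iff.rfl
  obtain ⟨T, S, hTS⟩ := h (ZLattice.comap ℝ X.lattice e.toLinearMap) (fun v hv => by
    rw [hmem] at hv ⊢
    have h1 : μ * v = L (A (L.symm v)) := by
      ext i
      rw [hL, L.apply_symm_apply]; rfl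
    rw [h1, L.symm_apply_apply]
    exact hA _ hv)
  refine Set.mem_iUnion.2 ⟨S, L.trans T, fun v => ?_⟩
  have h2 := hTS (L v)
  rw [hmem, L.symm_apply_apply] at h2
  exact h2

/-- Without squares no eigenvalue is real, so `P` is the minimal polynomial of both `α` and `β`. Its
roots have modulus at most `lam`, which bounds its coefficients and leaves finitely many pairs of
eigenvalues. -/
theorem finite_isoClass_of_forall_not_sq {lam : ℝ} (hlam : 1 < lam)
    (h1 : ∀ m : ℤ, lam + lam⁻¹ + 2 ≠ (m : ℝ) ^ 2) (h2 : ∀ m : ℤ, lam + lam⁻¹ - 2 ≠ (m : ℝ) ^ 2) :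
    (isoClass '' {X | X.AdmitsAutomorphismOfEntropy (Real.log lam)}).Finite := by
  classical
  set K : ℝ := max lam 1 ^ 4 * (4 : ℕ).choose (4 / 2) with hK
  have hU : {n : ℤ | |(n : ℝ)| ≤ K}.Finite := by
    refine (Set.finite_Icc (-⌊K⌋) ⌊K⌋).subset fun n (hn : |(n : ℝ)| ≤ K) => ?_
    obtain ⟨hn1, hn2⟩ := abs_le.1 hn
    refine ⟨neg_le.1 (Int.le_floor.2 (by push_cast; linarith)), Int.le_floor.2 hn2⟩
  have hF := Polynomial.bUnion_roots_finite (Int.castRingHom ℂ) 4 hU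
  set F : Set ℂ := ⋃ (f : ℤ[X]) (_ : f.natDegree ≤ 4 ∧ ∀ i, f.coeff i ∈ {n : ℤ | |(n : ℝ)| ≤ K}),
    ((f.map (Int.castRingHom ℂ)).roots.toFinset : Set ℂ)
  set G : Set (Fin 2 → ℂ) := {μ | (∀ i, μ i ∈ F) ∧
    ∀ i, ∀ c : Fin 4 → ℤ, ∑ k, c k * μ i ^ (k : ℕ) = 0 → c = 0}
  have hG : G.Finite := (Set.Finite.pi' fun _ => hF).subset fun μ hμ => hμ.1
  refine (hG.biUnion fun μ hμ => finite_isoClass_of_eigenvalues hμ.2).subset ?_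
  rw [← Set.image_iUnion₂]
  refine Set.image_mono fun X hX => ?_
  obtain ⟨A, L, α, β, P, hA, hL, hPm, hP, hαβ, hα⟩ := hX.exists_eigenvalues hlam
  refine Set.mem_iUnion₂.2 ⟨![α, β], ?_, A, L, hA, hL⟩
  -- The quartic lemmas treat their first root, so the roles of `α` and `β` are exchanged to treat
  -- `β`.
  have hP' : P.map (Int.castRingHom ℂ) = (Polynomial.X - C β) * (Polynomial.X - C α) *
      ((Polynomial.X - C (conj β)) * (Polynomial.X - C (conj α))) := by rw [hP]; ring
  have hβα : ‖β‖ * ‖α‖ = 1 := by rwa [mul_comm]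
  have hα0 : 0 < ‖α‖ := by
    refine (norm_nonneg α).lt_of_ne fun h0 => ?_
    rw [← h0, zero_mul] at hαβ
    exact zero_ne_one hαβ
  have hβ : ‖β‖ = ‖α‖⁻¹ := eq_inv_of_mul_eq_one_left hβα
  have hβ2 : ‖β‖ ^ 2 = lam⁻¹ := by rw [hβ, inv_pow, hα]
  have hα1 : 1 < ‖α‖ := by nlinarith
  have hβ1 : ‖β‖ < 1 := by rw [hβ]; exact inv_lt_one_of_one_lt₀ hα1
  have hαr : conj α ≠ α := fun hr => by
    obtain ⟨n, hn | hn⟩ := exists_int_sq_of_root_real hPm hP hαβ hα1.ne' hr <;>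
      rw [hα, hβ2] at hn
    exacts [h1 n hn, h2 n hn]
  have hβr : conj β ≠ β := fun hr => by
    obtain ⟨n, hn | hn⟩ := exists_int_sq_of_root_real hPm hP' hβα hβ1.ne hr <;>
      rw [hα, hβ2, add_comm lam⁻¹] at hn
    exacts [h1 n hn, h2 n hn]
  have hmα := minpoly_eq_of_roots_not_real hPm hP hαβ hα1.ne' hαr hβr
  have hmβ := minpoly_eq_of_roots_not_real hPm hP' hβα hβ1.ne hβr hαr
  obtain ⟨hev, hdeg, -⟩ := eval_and_natDegree_and_coeff_zero_of_roots hPm hP hαβ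
  have hroot : ∀ z, z ∈ (P.map (Int.castRingHom ℂ)).roots ↔ aeval z P = 0 := by
    intro z
    rw [mem_roots (hPm.map _).ne_zero, IsRoot, eval_map]
    rfl
  have hPα : aeval α P = 0 := by rw [hev]; simp
  have hPβ : aeval β P = 0 := by rw [hev]; simp
  have hcoeff : ∀ i, |(P.coeff i : ℝ)| ≤ K := by
    intro i
    have h3 := Polynomial.coeff_bdd_of_roots_le (p := P) (B := lam) (d := 4)
      (Int.castRingHom ℂ) hPm (IsAlgClosed.splits _) hdeg.le (fun z hz => by
        rw [hroot, hev] at hz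
        have hαl : ‖α‖ ≤ lam := by nlinarith
        have hβl : ‖β‖ ≤ lam := by linarith
        rcases mul_eq_zero.1 hz with hz | hz <;> rcases mul_eq_zero.1 hz with hz | hz <;>
          rw [sub_eq_zero.1 hz] <;> simpa) i
    rw [coeff_map] at h3
    simpa using h3
  have hPF : ∀ z, aeval z P = 0 → z ∈ F := fun z hz => Set.mem_iUnion₂.2
    ⟨P, ⟨hdeg.le, hcoeff⟩, Finset.mem_coe.2 (Multiset.mem_toFinset.2 ((hroot z).2 hz))⟩
  refine ⟨fun i => ?_, fun i c hc => ?_⟩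
  · fin_cases i
    exacts [hPF α hPα, hPF β hPβ]
  · fin_cases i
    · exact eq_zero_of_sum_mul_pow_eq_zero (z := α) ⟨P, hPm, hPα⟩ (by rw [hmα, hdeg]) hc
    · exact eq_zero_of_sum_mul_pow_eq_zero (z := β) ⟨P, hPm, hPβ⟩ (by rw [hmβ, hdeg]) hc

end ComplexTwoTorus

theorem theorem1p2 (lam : ℝ) (hlam : IsSalemNumber lam)
    (hent : ∃ X : ComplexTwoTorus, X.AdmitsAutomorphismOfEntropy (Real.log lam)) :
    ((∃ m : ℤ, lam + lam⁻¹ + 2 = (m : ℝ) ^ 2) ∨ (∃ m : ℤ, lam + lam⁻¹ - 2 = (m : ℝ) ^ 2)) ∨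
      (ComplexTwoTorus.isoClass ''
        {X : ComplexTwoTorus | X.AdmitsAutomorphismOfEntropy (Real.log lam)}).Finite := by
  refine or_iff_not_imp_left.2 fun h => ?_
  push Not at h
  exact ComplexTwoTorus.finite_isoClass_of_forall_not_sq hlam.1 h.1 h.2
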